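/- Let $\lambda_1>0$, $\lambda_2\neq 0$, $\omega<0$ and $Z\in\mathbb R$ be such that either (i) $\lambda_2>0$ and $\frac{Z^2}{4}<-\omega$, or (ii) $\lambda_2<0$ and $\frac{Z^2}{4}<-\omega<-\frac{3\lambda_1^2}{16\lambda_2}$. Put $\alpha=\frac{\lambda_1}{4}$, $\beta=\frac{\lambda_2}{3}$, $\gamma=\sqrt{\alpha^2-\beta\omega}$, let $R:\mathbb R\to(-1,1)$ be the increasing bijection $$R(s)=\frac{\gamma\sinh(2\sqrt{-\omega}\,s)}{\alpha+\gamma\cosh(2\sqrt{-\omega}\,s)},$$ and let $$\phi_{\omega,Z}(x)=\left[\frac{\alpha}{-\omega}+\frac{\gamma}{-\omega}\cosh\Big(2\sqrt{-\omega}\Big(|x|+R^{-1}\Big(\frac{Z}{2\sqrt{-\omega}}\Big)\Big)\Big)\right]^{-1/2},\qquad x\in\mathbb R.$$ Consider in $L^2(\mathbb R)$ (real- or complex-valued functions) the linear operator $$\mathcal L_{1,Z}\,g=-g''-\omega g-3\lambda_1\phi_{\omega,Z}^2\,g-5\lambda_2\phi_{\omega,Z}^4\,g \quad\text{on } \mathbb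 R\setminus\{0\},$$ with domain $$D_Z=\{g\in H^1(\mathbb R)\cap H^2(\mathbb R\setminus\{0\}) : g'(0+)-g'(0-)=-Z\,g(0)\},$$ and let $n(\mathcal L_{1,Z})$ denote the number of its negative eigenvalues. Then, whether the eigenvalues are counted with multiplicity or without multiplicity, 1. if $Z<0$, then $n(\mathcal L_{1,Z})=2$; 2. if $Z>0$, then $n(\mathcal L_{1,Z})=1$. -/

import Mathlib

open MeasureTheory Filter Topology

noncomputable section

namespace DeltaNLS

/-! ### The explicit profile -/

/-- The function `R(s) = γ sinh(2 √(-ω) s) / (α + γ cosh(2 √(-ω) s))`, where `α = lam₁ / 4`,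
`β = lam₂ / 3` and `γ = √(α² - β ω)`.  For admissible parameters it is an increasing bijection
of the real line onto `(-1, 1)`. -/
def R (lam₁ lam₂ ω s : ℝ) : ℝ :=
  √((lam₁ / 4) ^ 2 - lam₂ / 3 * ω) * Real.sinh (2 * √(-ω) * s) /
    (lam₁ / 4 + √((lam₁ / 4) ^ 2 - lam₂ / 3 * ω) * Real.cosh (2 * √(-ω) * s))

/-- The shift `R⁻¹(Z / (2 √(-ω)))`. -/
def shift (lam₁ lam₂ ω Z : ℝ) : ℝ :=
  Function.invFun (R lam₁ lam₂ ω) (Z / (2 * √(-ω)))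

/-- The peak profile
`φ(x) = [α / (-ω) + γ / (-ω) cosh(2 √(-ω) (|x| + R⁻¹(Z / (2 √(-ω)))))] ^ (-1/2)`. -/
def profile (lam₁ lam₂ ω Z x : ℝ) : ℝ :=
  ((lam₁ / 4) / (-ω) + √((lam₁ / 4) ^ 2 - lam₂ / 3 * ω) / (-ω) *
    Real.cosh (2 * √(-ω) * (|x| + shift lam₁ lam₂ ω Z))) ^ (-(1 / 2) : ℝ)

/-- Admissible parameters: either attractive-attractive or attractive-repulsive. -/
def Admissible (lam₁ lam₂ ω Z : ℝ) : Prop :=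
  ω < 0 ∧
  ((0 < lam₁ ∧ 0 < lam₂ ∧ Z ^ 2 / 4 < -ω) ∨
   (0 < lam₁ ∧ lam₂ < 0 ∧ Z ^ 2 / 4 < -ω ∧ -ω < -(3 * lam₁ ^ 2) / (16 * lam₂)))

/-! ### Weak derivatives, traces and the delta interaction in `L²(ℝ)` -/

section Operators

variable (𝕜 : Type*) [RCLike 𝕜]

/-- The Hilbert space `L²(ℝ; 𝕜)`, with `𝕜` the real or the complex field. -/
abbrev L2 : Type _ := Lp 𝕜 2 (volume : Measure ℝ)

variable {𝕜}

/-- `v` is the weak derivative of `u` on the open set `U`, i.e. `∫ ψ' u = - ∫ ψ v` for all real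
test functions `ψ ∈ C_c^∞(U)`. -/
def IsWeakDeriv (U : Set ℝ) (u v : L2 𝕜) : Prop :=
  ∀ ψ : ℝ → ℝ, ContDiff ℝ (⊤ : ℕ∞) ψ → HasCompactSupport ψ → tsupport ψ ⊆ U →
    ∫ x, deriv ψ x • u x = -∫ x, ψ x • v x

/-- `u` has essential limit `a` along the filter `l` of subsets of the line.  Along `𝓝 0`,
`𝓝[>] 0`, `𝓝[<] 0` this is the value at `0`, `0+`, `0-` of the continuous representative of `u`
whenever such a representative exists near (respectively right of, left of) `0`. -/
def HasTrace (l : Filter ℝ) (u : L2 𝕜) (a : 𝕜) : Prop :=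
  Tendsto u (l ⊓ ae (volume : Measure ℝ)) (𝓝 a)

/-- `u ∈ H¹(ℝ)`. -/
def MemH1 (u : L2 𝕜) : Prop := ∃ v, IsWeakDeriv Set.univ u v

/-- `u ∈ H²(ℝ - {0})`, with first and second weak derivatives `v` and `w` there. -/
def IsH2Off (u v w : L2 𝕜) : Prop := IsWeakDeriv {0}ᶜ u v ∧ IsWeakDeriv {0}ᶜ v w

/-- The jump condition `v(0+) - v(0-) = -Z u(0)` (used with `v = u'`). -/
def JumpCond (Z : ℝ) (u v : L2 𝕜) : Prop :=
  ∃ a b c : 𝕜, HasTrace (𝓝[>] 0) v a ∧ HasTrace (𝓝[<] 0) v b ∧ HasTrace (𝓝 0) u c ∧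
    a - b = -(Z : 𝕜) * c

lemma integrable_test {ψ : ℝ → ℝ} (hc : Continuous ψ) (hs : HasCompactSupport ψ) (u : L2 𝕜) :
    Integrable (fun x => ψ x • u x) := by
  have h1 : MemLp ψ 2 (volume : Measure ℝ) := hc.memLp_of_hasCompactSupport hs
  have h2 : MemLp u 2 (volume : Measure ℝ) := Lp.memLp u
  exact memLp_one_iff_integrable.1 (h2.smul (r := 1) h1)

lemma IsWeakDeriv.add {U : Set ℝ} {u v u' v' : L2 𝕜} (h : IsWeakDeriv U u v)
    (h' : IsWeakDeriv U u' v') : IsWeakDeriv U (u + u') (v + v') := by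
  intro ψ hψ hs hU
  have hd : Continuous (deriv ψ) := hψ.continuous_deriv (by simp)
  have e1 : ∫ x, deriv ψ x • (u + u' : L2 𝕜) x
      = ∫ x, (deriv ψ x • u x + deriv ψ x • u' x) := by
    refine integral_congr_ae ?_
    filter_upwards [Lp.coeFn_add u u'] with x hx
    rw [hx, Pi.add_apply, smul_add]
  have e2 : ∫ x, ψ x • (v + v' : L2 𝕜) x = ∫ x, (ψ x • v x + ψ x • v' x) := by
    refine integral_congr_ae ?_
    filter_upwards [Lp.coeFn_add v v'] with x hx
    rw [hx, Pi.add_apply, smul_add]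
  rw [e1, e2, integral_add (integrable_test hd hs.deriv u) (integrable_test hd hs.deriv u'),
    integral_add (integrable_test hψ.continuous hs v) (integrable_test hψ.continuous hs v'),
    h ψ hψ hs hU, h' ψ hψ hs hU]
  ring

lemma IsWeakDeriv.smul {U : Set ℝ} {u v : L2 𝕜} (k : 𝕜) (h : IsWeakDeriv U u v) :
    IsWeakDeriv U (k • u) (k • v) := by
  intro ψ hψ hs hU
  have e1 : ∫ x, deriv ψ x • (k • u : L2 𝕜) x = ∫ x, k • (deriv ψ x • u x) := by
    refine integral_congr_ae ?_
    filter_upwards [Lp.coeFn_smul k u] with x hx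
    rw [hx, Pi.smul_apply, smul_comm]
  have e2 : ∫ x, ψ x • (k • v : L2 𝕜) x = ∫ x, k • (ψ x • v x) := by
    refine integral_congr_ae ?_
    filter_upwards [Lp.coeFn_smul k v] with x hx
    rw [hx, Pi.smul_apply, smul_comm]
  rw [e1, e2, integral_smul, integral_smul, h ψ hψ hs hU, smul_neg]

lemma IsWeakDeriv.zero {U : Set ℝ} : IsWeakDeriv U (0 : L2 𝕜) 0 := by
  intro ψ hψ hs hU
  have e (ψ : ℝ → ℝ) : ∫ x, ψ x • (0 : L2 𝕜) x = 0 := by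
    rw [← integral_zero ℝ 𝕜]
    refine integral_congr_ae ?_
    filter_upwards [Lp.coeFn_zero 𝕜 2 (volume : Measure ℝ)] with x hx
    rw [hx, Pi.zero_apply, smul_zero]
  rw [e, e, neg_zero]

/-- Weak derivatives on `ℝ - {0}` are unique in `L²(ℝ)`. -/
lemma IsWeakDeriv.unique {u v v' : L2 𝕜} (h : IsWeakDeriv {0}ᶜ u v)
    (h' : IsWeakDeriv {0}ᶜ u v') : v = v' := by
  have hv (v : L2 𝕜) : LocallyIntegrable v (volume : Measure ℝ) :=
    (Lp.memLp v).locallyIntegrable (by norm_num)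
  have hz := IsOpen.ae_eq_zero_of_integral_contDiff_smul_eq_zero (μ := (volume : Measure ℝ))
    (f := fun x => v x - v' x) (U := ({0}ᶜ : Set ℝ)) isOpen_compl_singleton
    (((hv v).sub (hv v')).locallyIntegrableOn _) (by
      intro ψ hψ hs hU
      simp only [smul_sub]
      rw [integral_sub (integrable_test hψ.continuous hs v)
        (integrable_test hψ.continuous hs v')]
      have := h ψ hψ hs hU
      rw [h' ψ hψ hs hU, neg_inj] at this
      rw [this, sub_self])
  apply Lp.ext
  have h0 : ∀ᵐ x ∂(volume : Measure ℝ), x ∈ ({0}ᶜ : Set ℝ) := by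
    simp [ae_iff]
  filter_upwards [hz, h0] with x hx hx0
  exact sub_eq_zero.1 (hx hx0)

lemma HasTrace.add {l : Filter ℝ} {u u' : L2 𝕜} {a a' : 𝕜} (h : HasTrace l u a)
    (h' : HasTrace l u' a') : HasTrace l (u + u') (a + a') := by
  refine (Tendsto.add h h').congr' ?_
  filter_upwards [(Lp.coeFn_add u u').filter_mono inf_le_right] with x hx
  rw [hx, Pi.add_apply]

lemma HasTrace.smul {l : Filter ℝ} {u : L2 𝕜} {a : 𝕜} (k : 𝕜) (h : HasTrace l u a) :
    HasTrace l (k • u) (k * a) := by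
  refine (Tendsto.const_mul k h).congr' ?_
  filter_upwards [(Lp.coeFn_smul k u).filter_mono inf_le_right] with x hx
  rw [hx, Pi.smul_apply, smul_eq_mul]

lemma HasTrace.zero {l : Filter ℝ} : HasTrace l (0 : L2 𝕜) 0 := by
  refine (tendsto_const_nhds (x := (0 : 𝕜))).congr' ?_
  filter_upwards [(Lp.coeFn_zero 𝕜 2 (volume : Measure ℝ)).filter_mono inf_le_right] with x hx
  rw [hx, Pi.zero_apply]

variable (𝕜)

/-- The domain
`D_Z = {u ∈ H¹(ℝ) ∩ H²(ℝ - {0}) : u'(0+) - u'(0-) = -Z u(0)}` of the delta interaction. -/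
def deltaDomain (Z : ℝ) : Submodule 𝕜 (L2 𝕜) where
  carrier := {u | MemH1 u ∧ ∃ v w, IsH2Off u v w ∧ JumpCond Z u v}
  zero_mem' := ⟨⟨0, .zero⟩, 0, 0, ⟨.zero, .zero⟩, 0, 0, 0, .zero, .zero, .zero, by simp⟩
  add_mem' := by
    rintro u u' ⟨⟨d, hd⟩, v, w, ⟨h1, h2⟩, a, b, c, ha, hb, hc, e⟩
      ⟨⟨d', hd'⟩, v', w', ⟨h1', h2'⟩, a', b', c', ha', hb', hc', e'⟩
    refine ⟨⟨_, hd.add hd'⟩, _, _, ⟨h1.add h1', h2.add h2'⟩, _, _, _, ha.add ha', hb.add hb',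
      hc.add hc', ?_⟩
    linear_combination e + e'
  smul_mem' := by
    rintro k u ⟨⟨d, hd⟩, v, w, ⟨h1, h2⟩, a, b, c, ha, hb, hc, e⟩
    refine ⟨⟨_, hd.smul k⟩, _, _, ⟨h1.smul k, h2.smul k⟩, _, _, _, ha.smul k, hb.smul k,
      hc.smul k, ?_⟩
    linear_combination k * e

variable {𝕜}

lemma exists_second {Z : ℝ} (u : deltaDomain 𝕜 Z) :
    ∃ w : L2 𝕜, ∃ v : L2 𝕜, IsH2Off (u : L2 𝕜) v w := by
  obtain ⟨_, v, w, h, _⟩ := u.2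
  exact ⟨w, v, h⟩

/-- The second weak derivative on `ℝ - {0}` of an element of `D_Z`. -/
def secondDeriv {Z : ℝ} (u : deltaDomain 𝕜 Z) : L2 𝕜 := (exists_second u).choose

lemma secondDeriv_eq {Z : ℝ} {u : deltaDomain 𝕜 Z} {v w : L2 𝕜}
    (h : IsH2Off (u : L2 𝕜) v w) : secondDeriv u = w := by
  obtain ⟨v', h1, h2⟩ := (exists_second u).choose_spec
  obtain rfl := h1.unique h.1
  exact h2.unique h.2

variable (𝕜)

/-- The self-adjoint realization `A_Z u = -u''` (off the origin) of `-∂² - Z δ`, on `D_Z`. -/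
def deltaOp (Z : ℝ) : L2 𝕜 →ₗ.[𝕜] L2 𝕜 where
  domain := deltaDomain 𝕜 Z
  toFun :=
    { toFun := fun u => -secondDeriv u
      map_add' := by
        intro u u'
        obtain ⟨v, h1, h2⟩ := (exists_second u).choose_spec
        obtain ⟨v', h1', h2'⟩ := (exists_second u').choose_spec
        rw [secondDeriv_eq (u := u + u') ⟨h1.add h1', h2.add h2'⟩, neg_add]
        rfl
      map_smul' := by
        intro k u
        obtain ⟨v, h1, h2⟩ := (exists_second u).choose_spec
        rw [secondDeriv_eq (u := k • u) ⟨h1.smul k, h2.smul k⟩, RingHom.id_apply, smul_neg]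
        rfl }

/-- The operator of multiplication by the real function `V`, on its maximal domain
`{u ∈ L² : V u ∈ L²}` (all of `L²` for bounded measurable `V`). -/
def mulOp (V : ℝ → ℝ) : L2 𝕜 →ₗ.[𝕜] L2 𝕜 where
  domain :=
    { carrier := {u | MemLp (fun x => (V x : 𝕜) * u x) 2 (volume : Measure ℝ)}
      zero_mem' := by
        refine (memLp_congr_ae ?_).1 (MemLp.zero (ε := 𝕜))
        filter_upwards [Lp.coeFn_zero 𝕜 2 (volume : Measure ℝ)] with x hx
        rw [hx, Pi.zero_apply, mul_zero]
      add_mem' := by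
        intro u u' h h'
        refine (memLp_congr_ae ?_).1 (MemLp.add h h')
        filter_upwards [Lp.coeFn_add u u'] with x hx
        rw [hx, Pi.add_apply, Pi.add_apply, mul_add]
      smul_mem' := by
        intro k u h
        refine (memLp_congr_ae ?_).1 (MemLp.const_mul h k)
        filter_upwards [Lp.coeFn_smul k u] with x hx
        simp only [hx, Pi.smul_apply, smul_eq_mul]
        ring }
  toFun :=
    { toFun := fun u => MemLp.toLp (fun x => (V x : 𝕜) * (u : L2 𝕜) x) u.2
      map_add' := by
        intro u u'
        apply Lp.ext
        refine (MemLp.coeFn_toLp _).trans ?_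
        filter_upwards [Lp.coeFn_add (u : L2 𝕜) (u' : L2 𝕜), MemLp.coeFn_toLp u.2,
          MemLp.coeFn_toLp u'.2, Lp.coeFn_add
            (MemLp.toLp (fun x => (V x : 𝕜) * (u : L2 𝕜) x) u.2)
            (MemLp.toLp (fun x => (V x : 𝕜) * (u' : L2 𝕜) x) u'.2)] with x hx h1 h2 h3
        rw [h3, Pi.add_apply, h1, h2, Submodule.coe_add, hx, Pi.add_apply, mul_add]
      map_smul' := by
        intro k u
        apply Lp.ext
        refine (MemLp.coeFn_toLp _).trans ?_
        filter_upwards [Lp.coeFn_smul k (u : L2 𝕜), MemLp.coeFn_toLp u.2, Lp.coeFn_smul k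
            (MemLp.toLp (fun x => (V x : 𝕜) * (u : L2 𝕜) x) u.2)] with x hx h1 h3
        rw [RingHom.id_apply, h3, Pi.smul_apply, h1, Submodule.coe_smul, hx, Pi.smul_apply,
          smul_eq_mul, smul_eq_mul]
        ring }

/-- The potential `-ω - 3 lam₁ φ² - 5 lam₂ φ⁴`. -/
def potential (lam₁ lam₂ ω Z x : ℝ) : ℝ :=
  -ω - 3 * lam₁ * profile lam₁ lam₂ ω Z x ^ 2 - 5 * lam₂ * profile lam₁ lam₂ ω Z x ^ 4

/-- The linearized operator `L_{1,Z} = -∂² - ω - 3 lam₁ φ² - 5 lam₂ φ⁴` with the delta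
interaction condition of strength `Z` at the origin. -/
def L1 (lam₁ lam₂ ω Z : ℝ) : L2 𝕜 →ₗ.[𝕜] L2 𝕜 :=
  deltaOp 𝕜 Z + mulOp 𝕜 (potential lam₁ lam₂ ω Z)

/-- For admissible parameters the potential is bounded, so `L_{1,Z}` has domain exactly `D_Z`. -/
lemma L1_domain {lam₁ lam₂ ω Z : ℝ} (h : Admissible lam₁ lam₂ ω Z) :
    (L1 𝕜 lam₁ lam₂ ω Z).domain = deltaDomain 𝕜 Z := by
  have hω : 0 < -ω := by have := h.1; linarith
  have hlam : 0 < lam₁ := by rcases h.2 with h | h <;> exact h.1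
  set m : ℝ := ((lam₁ / 4) / (-ω)) ^ (-(1 / 2) : ℝ) with hm
  have hb (x : ℝ) : |profile lam₁ lam₂ ω Z x| ≤ m := by
    have hle : (lam₁ / 4) / (-ω) ≤ (lam₁ / 4) / (-ω) +
        √((lam₁ / 4) ^ 2 - lam₂ / 3 * ω) / (-ω) *
        Real.cosh (2 * √(-ω) * (|x| + shift lam₁ lam₂ ω Z)) := by
      have : 0 ≤ √((lam₁ / 4) ^ 2 - lam₂ / 3 * ω) / (-ω) *
        Real.cosh (2 * √(-ω) * (|x| + shift lam₁ lam₂ ω Z)) :=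
        mul_nonneg (div_nonneg (Real.sqrt_nonneg _) hω.le) (Real.cosh_pos _).le
      linarith
    have hpos : 0 < (lam₁ / 4) / (-ω) := by positivity
    unfold profile
    rw [abs_of_nonneg (Real.rpow_nonneg (hpos.le.trans hle) _)]
    exact Real.rpow_le_rpow_of_nonpos hpos hle (by norm_num)
  have hmeas : Measurable (profile lam₁ lam₂ ω Z) := by
    unfold profile
    refine Measurable.pow_const ?_ _
    exact (Continuous.measurable (by fun_prop))
  have hpm : Measurable (potential lam₁ lam₂ ω Z) := by
    unfold potential
    fun_prop
  have hpb (x : ℝ) : |potential lam₁ lam₂ ω Z x| ≤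
      |ω| + |3 * lam₁| * m ^ 2 + |5 * lam₂| * m ^ 4 := by
    unfold potential
    have h2 : |profile lam₁ lam₂ ω Z x| ^ 2 ≤ m ^ 2 := by gcongr; exact hb x
    have h4 : |profile lam₁ lam₂ ω Z x| ^ 4 ≤ m ^ 4 := by gcongr; exact hb x
    refine (abs_sub _ _).trans (add_le_add ((abs_sub _ _).trans (add_le_add ?_ ?_)) ?_)
    · rw [abs_neg]
    · rw [abs_mul, abs_pow]
      gcongr
    · rw [abs_mul, abs_pow]
      gcongr
  refine inf_eq_left.2 fun u _ => ?_
  change MemLp (fun x => (potential lam₁ lam₂ ω Z x : 𝕜) * u x) 2 (volume : Measure ℝ)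
  refine MemLp.of_le_mul (c := |ω| + |3 * lam₁| * m ^ 2 + |5 * lam₂| * m ^ 4) (Lp.memLp u) ?_ ?_
  · exact ((RCLike.continuous_ofReal.measurable.comp hpm).aestronglyMeasurable).mul
      (Lp.aestronglyMeasurable u)
  · refine Filter.Eventually.of_forall fun x => ?_
    rw [norm_mul, RCLike.norm_ofReal]
    gcongr
    exact hpb x

end Operators

/-! ### Counting negative eigenvalues -/

section Eigen

variable {𝕜 E : Type*} [RCLike 𝕜] [AddCommGroup E] [Module 𝕜 E]

/-- The eigenspace `{u ∈ D(T) : T u = μ u}` of an unbounded operator. -/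
def eigenspace (T : E →ₗ.[𝕜] E) (μ : 𝕜) : Submodule 𝕜 E where
  carrier := {u | ∃ h : u ∈ T.domain, T ⟨u, h⟩ = μ • u}
  zero_mem' := ⟨T.domain.zero_mem, by
    rw [smul_zero]
    exact T.map_zero⟩
  add_mem' := by
    rintro u v ⟨hu, eu⟩ ⟨hv, ev⟩
    refine ⟨T.domain.add_mem hu hv, ?_⟩
    rw [smul_add, ← eu, ← ev, ← T.map_add]
    rfl
  smul_mem' := by
    rintro k u ⟨hu, eu⟩
    refine ⟨T.domain.smul_mem k hu, ?_⟩
    rw [smul_comm, ← eu, ← T.map_smul]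
    rfl

/-- The set of (real) negative eigenvalues. -/
def negEigenvalues (T : E →ₗ.[𝕜] E) : Set ℝ :=
  {μ | μ < 0 ∧ ∃ u : E, u ≠ 0 ∧ u ∈ eigenspace T (μ : 𝕜)}

/-- `n(T)`, the number of negative eigenvalues counted with multiplicity: the sum of the
dimensions of the eigenspaces over all negative reals, with value in `ℕ ∪ {∞}`. -/
def numNegEigenvalues (T : E →ₗ.[𝕜] E) : ℕ∞ :=
  ∑' μ : Set.Iio (0 : ℝ), Cardinal.toENat (Module.rank 𝕜 (eigenspace T ((μ : ℝ) : 𝕜)))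

end Eigen

end DeltaNLS

end

/-! The potential is even, so an eigenfunction splits into an even and an odd part, and the spectral
problem becomes two problems `f'' = (q - μ) f` on `[0, ∞)`. The even one, `E`, has data `(1, -Z/2)`,
half of the jump condition; the odd one, `O`, has data `(0, 1)`. For `μ < 0` the potential term `q -
μ` is bounded below by a positive constant far out, so a solution either decays or grows, and `μ` is
an eigenvalue exactly when `E` or `O` decays. Their Wronskian is a nonzero constant, so both cannot
decay: every negative eigenvalue is simple and the two ways of counting agree (`rank_eigenspace`,
`count_eq`).

Everything is compared with one explicit zero-energy solution. Differentiating the soliton equation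
shows that `ψ`, a multiple of the derivative of the shifted soliton, solves `ψ'' = q ψ`; it decays
and is finally negative. Since the logarithmic derivative of the soliton at the shift is `-Z/2`,
strict log-concavity gives `-(Z/2) ψ(0) - ψ'(0) > 0`. For `Z > 0` the shift is positive and `ψ` has
no zero on the half-line; for `Z < 0` it is negative, `ψ(0) > 0`, and `ψ` has one zero `x₀`.

Existence (`exists_decaying`) is by shooting in `μ`. For very negative `μ` the solution grows to the
positive side; at `μ = 0` a Wronskian with `ψ` forces growth to the negative side. Both behaviours
are open in `μ` and exclude each other, so a decaying solution lies in between. The required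
Wronskian sign is log-concavity for `E`, and `ψ(0) > 0` for `O`.

Uniqueness (`no_combination`) is Jacobi's argument. Two decaying solutions at negative parameters
have a nontrivial combination `h` with `h(x₀) = 0`. The quadratic form is negative on it, but
completing the square with `ψ'/ψ` shows that it is nonnegative. Hence `E` contributes one eigenvalue
for either sign of `Z`, and `O` contributes one when `Z < 0` and none when `Z > 0`. -/

namespace DeltaNLS

/-! ### Initial value problems: existence, uniqueness, dependence on the parameter -/

open BoundedContinuousFunction in
/-- Global forward solvability of an ordinary differential equation with a uniformly Lipschitz
right-hand side vanishing at the origin. -/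
theorem exists_global_solution {E : Type*} [NormedAddCommGroup E] [NormedSpace ℝ E]
    [CompleteSpace E] {v : ℝ → E → E} (hv : Continuous (Function.uncurry v)) {K : ℝ} (hK : 0 < K)
    (hlip : ∀ t p p', ‖v t p - v t p'‖ ≤ K * ‖p - p'‖) (hzero : ∀ t, v t 0 = 0) (x₀ : E) :
    ∃ α : ℝ → E, α 0 = x₀ ∧ ∀ x, 0 ≤ x → HasDerivAt α (v x (α x)) x := by
  have hexp (y : ℝ) (C : ℝ) :
      ∫ t in (0 : ℝ)..y, K * (Real.exp (2 * K * t) * C) = (Real.exp (2 * K * y) - 1) / 2 * C := by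
    have h : ∀ t ∈ Set.uIcc 0 y, HasDerivAt (fun t => Real.exp (2 * K * t) / 2 * C)
        (K * (Real.exp (2 * K * t) * C)) t := by
      intro t _
      have := (((hasDerivAt_id t).const_mul (2 * K)).exp.div_const 2).mul_const C
      refine this.congr_deriv ?_
      simp only [id]
      ring
    rw [intervalIntegral.integral_eq_sub_of_hasDerivAt h
      (Continuous.intervalIntegrable (by fun_prop) _ _)]
    simp
    ring
  have hcont (w : ℝ →ᵇ E) : Continuous fun t => v t (Real.exp (2 * K * t) • w t) := by
    have : Continuous fun t => (t, Real.exp (2 * K * t) • w t) := by fun_prop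
    exact hv.comp this
  have hprim (w : ℝ →ᵇ E) :
      Continuous fun y => ∫ t in (0 : ℝ)..y, v t (Real.exp (2 * K * t) • w t) :=
    intervalIntegral.continuous_primitive (fun a b => (hcont w).intervalIntegrable a b) 0
  have hdiff (w w' : ℝ →ᵇ E) (y : ℝ) (hy : 0 ≤ y) :
      ‖(∫ t in (0 : ℝ)..y, v t (Real.exp (2 * K * t) • w t)) -
        ∫ t in (0 : ℝ)..y, v t (Real.exp (2 * K * t) • w' t)‖ ≤
        (Real.exp (2 * K * y) - 1) / 2 * dist w w' := by
    rw [← intervalIntegral.integral_sub ((hcont w).intervalIntegrable _ _)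
      ((hcont w').intervalIntegrable _ _), ← hexp y]
    refine intervalIntegral.norm_integral_le_of_norm_le hy ?_
      (Continuous.intervalIntegrable (by fun_prop) _ _)
    refine Eventually.of_forall fun t _ => (hlip _ _ _).trans ?_
    rw [← smul_sub, norm_smul, Real.norm_of_nonneg (Real.exp_pos _).le]
    gcongr
    rw [← dist_eq_norm]
    exact dist_coe_le_dist t
  have hweight (y : ℝ) (hy : 0 ≤ y) (C : ℝ) (hC : 0 ≤ C) :
      Real.exp (-(2 * K * y)) * ((Real.exp (2 * K * y) - 1) / 2 * C) ≤ 1 / 2 * C := by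
    have h1 : Real.exp (-(2 * K * y)) * Real.exp (2 * K * y) = 1 := by
      rw [← Real.exp_add]; simp
    have h2 := Real.exp_pos (-(2 * K * y))
    nlinarith [mul_nonneg h2.le hC]
  -- Picard iteration for the weighted unknown `w(x) = exp(-2Kx) α(x)`. The weight makes the map a
  -- contraction with constant `1/2` on the whole half-line, so no local solutions need be glued.
  -- The absolute value extends `w` evenly, which lets the bounded continuous functions on `ℝ` serve
  -- as the complete space.
  let T : (ℝ →ᵇ E) → (ℝ →ᵇ E) := fun w =>
    BoundedContinuousFunction.ofNormedAddCommGroup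
      (fun x => Real.exp (-(2 * K * |x|)) •
        (x₀ + ∫ t in (0 : ℝ)..|x|, v t (Real.exp (2 * K * t) • w t)))
      (by have := (hprim w).comp continuous_abs; fun_prop)
      (‖x₀‖ + 1 / 2 * dist w 0) (by
        intro x
        have h0 : (∫ t in (0 : ℝ)..|x|, v t (Real.exp (2 * K * t) • (0 : ℝ →ᵇ E) t)) = 0 := by
          simp [hzero]
        have h1 := hdiff w 0 |x| (abs_nonneg x)
        rw [h0, sub_zero] at h1
        rw [norm_smul, Real.norm_of_nonneg (Real.exp_pos _).le]
        have h2 : Real.exp (-(2 * K * |x|)) ≤ 1 := Real.exp_le_one_iff.2 (by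
          have := abs_nonneg x
          have := mul_nonneg hK.le this
          linarith)
        calc _ ≤ Real.exp (-(2 * K * |x|)) *
              (‖x₀‖ + (Real.exp (2 * K * |x|) - 1) / 2 * dist w 0) := by
              gcongr
              exact (norm_add_le _ _).trans (by gcongr)
          _ ≤ _ := by
              rw [mul_add]
              exact add_le_add (mul_le_of_le_one_left (norm_nonneg _) h2)
                (hweight _ (abs_nonneg x) _ dist_nonneg))
  have hT : ContractingWith (1 / 2) T := by
    refine ⟨by rw [← NNReal.coe_lt_coe]; norm_num, LipschitzWith.of_dist_le_mul fun w w' => ?_⟩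
    refine (BoundedContinuousFunction.dist_le (by positivity)).2 fun x => ?_
    rw [dist_eq_norm]
    change ‖Real.exp (-(2 * K * |x|)) • (x₀ + _) - Real.exp (-(2 * K * |x|)) • (x₀ + _)‖ ≤ _
    rw [← smul_sub, add_sub_add_left_eq_sub, norm_smul,
      Real.norm_of_nonneg (Real.exp_pos _).le]
    calc _ ≤ Real.exp (-(2 * K * |x|)) * ((Real.exp (2 * K * |x|) - 1) / 2 * dist w w') := by
          gcongr
          exact hdiff w w' _ (abs_nonneg x)
      _ ≤ _ := by
          simpa using hweight _ (abs_nonneg x) (dist w w') dist_nonneg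
  set w := ContractingWith.fixedPoint T hT with hw
  have hfix : T w = w := hT.fixedPoint_isFixedPt
  -- The integral, unlike the weighted fixed point, is differentiable from both sides at `0`; it
  -- agrees with the fixed point for `x ≥ 0`.
  refine ⟨fun x => x₀ + ∫ t in (0 : ℝ)..x, v t (Real.exp (2 * K * t) • w t), by simp,
    fun x hx => ?_⟩
  have hval : Real.exp (2 * K * x) • w x =
      x₀ + ∫ t in (0 : ℝ)..x, v t (Real.exp (2 * K * t) • w t) := by
    conv_lhs => rw [← hfix]
    change Real.exp (2 * K * x) • (Real.exp (-(2 * K * |x|)) • (x₀ + _)) = _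
    rw [abs_of_nonneg hx, smul_smul, ← Real.exp_add, add_neg_cancel, Real.exp_zero, one_smul]
  beta_reduce
  rw [← hval]
  exact (intervalIntegral.integral_hasDerivAt_right ((hcont w).intervalIntegrable _ _)
    ((hcont w).stronglyMeasurableAtFilter _ _) (hcont w).continuousAt).const_add x₀

/-- `f` solves `f'' = (q - μ) f` on the half-line `[0, ∞)`, and `f'` is its derivative. -/
structure IsSol (q : ℝ → ℝ) (μ : ℝ) (f f' : ℝ → ℝ) : Prop where
  deriv : ∀ x, 0 ≤ x → HasDerivAt f (f' x) x
  deriv' : ∀ x, 0 ≤ x → HasDerivAt f' ((q x - μ) * f x) x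

/-- The vector field of the first-order system of `f'' = (q - μ) f`. -/
def field (q : ℝ → ℝ) (μ t : ℝ) (p : ℝ × ℝ) : ℝ × ℝ := (p.2, (q t - μ) * p.1)

lemma field_lipschitz {q : ℝ → ℝ} {B : ℝ} (hB : ∀ x, |q x| ≤ B) (μ t : ℝ) (p p' : ℝ × ℝ) :
    ‖field q μ t p - field q μ t p'‖ ≤ (1 + B + |μ|) * ‖p - p'‖ := by
  have hB0 : 0 ≤ B := (abs_nonneg _).trans (hB 0)
  have hμ := abs_nonneg μ
  have hn := norm_nonneg (p - p')
  rw [Prod.norm_def]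
  refine max_le ?_ ?_
  · change ‖(p - p').2‖ ≤ _
    refine (norm_snd_le _).trans ?_
    nlinarith
  · have : (field q μ t p - field q μ t p').2 = (q t - μ) * (p - p').1 := by
      simp [field]; ring
    rw [this, norm_mul]
    refine mul_le_mul ?_ (norm_fst_le _) (norm_nonneg _) (by positivity)
    refine (abs_sub _ _).trans ?_
    linarith [hB t]

lemma IsSol.prod {q : ℝ → ℝ} {μ : ℝ} {f f' : ℝ → ℝ} (h : IsSol q μ f f') (x : ℝ) (hx : 0 ≤ x) :
    HasDerivAt (fun x => (f x, f' x)) (field q μ x (f x, f' x)) x :=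
  (h.deriv x hx).prodMk (h.deriv' x hx)

lemma exists_isSol {q : ℝ → ℝ} (hq : Continuous q) {B : ℝ} (hB : ∀ x, |q x| ≤ B) (μ a b : ℝ) :
    ∃ f f' : ℝ → ℝ, IsSol q μ f f' ∧ f 0 = a ∧ f' 0 = b := by
  have hB0 : 0 ≤ B := (abs_nonneg _).trans (hB 0)
  obtain ⟨α, h0, hα⟩ := exists_global_solution (v := field q μ) (K := 1 + B + |μ|)
    (by unfold Function.uncurry field; fun_prop) (by positivity) (field_lipschitz hB μ)
    (fun t => by simp [field]) (a, b)
  refine ⟨fun x => (α x).1, fun x => (α x).2, ⟨fun x hx => (hα x hx).fst, fun x hx =>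
    (hα x hx).snd⟩, by simp [h0], by simp [h0]⟩

lemma IsSol.unique {q : ℝ → ℝ} {B : ℝ} (hB : ∀ x, |q x| ≤ B) {μ : ℝ} {f f' g g' : ℝ → ℝ}
    (hf : IsSol q μ f f') (hg : IsSol q μ g g') {x₀ : ℝ} (hx₀ : 0 ≤ x₀) (h : f x₀ = g x₀)
    (h' : f' x₀ = g' x₀) {x : ℝ} (hx : 0 ≤ x) : f x = g x ∧ f' x = g' x := by
  have hB0 : 0 ≤ B := (abs_nonneg _).trans (hB 0)
  have hl : ∀ t, LipschitzOnWith ⟨1 + B + |μ|, by positivity⟩ (field q μ t) Set.univ := fun t =>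
    (LipschitzWith.of_dist_le_mul fun p p' => by
      rw [dist_eq_norm, dist_eq_norm]; exact field_lipschitz hB μ t p p').lipschitzOnWith
  have hc {f f' : ℝ → ℝ} (hf : IsSol q μ f f') (b : ℝ) :
      ContinuousOn (fun x => (f x, f' x)) (Set.Icc 0 b) := fun x hx =>
    (hf.prod x hx.1).continuousAt.continuousWithinAt
  have h0 : (fun x => (f x, f' x)) x₀ = (fun x => (g x, g' x)) x₀ := by simp [h, h']
  have key : (fun x => (f x, f' x)) x = (fun x => (g x, g' x)) x := by
    rcases le_total x x₀ with hxx | hxx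
    · exact ODE_solution_unique_of_mem_Icc_left (v := field q μ) (s := fun _ => Set.univ)
        (fun t _ => hl t) (hc hf x₀) (fun t ht => (hf.prod t ht.1.le).hasDerivWithinAt)
        (fun _ _ => trivial) (hc hg x₀) (fun t ht => (hg.prod t ht.1.le).hasDerivWithinAt)
        (fun _ _ => trivial) h0 ⟨hx, hxx⟩
    · refine ODE_solution_unique_of_mem_Icc_right (v := field q μ) (s := fun _ => Set.univ)
        (fun t _ => hl t) ((hc hf x).mono (Set.Icc_subset_Icc_left hx₀))
        (fun t ht => (hf.prod t (hx₀.trans ht.1)).hasDerivWithinAt)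
        (fun _ _ => trivial) ((hc hg x).mono (Set.Icc_subset_Icc_left hx₀))
        (fun t ht => (hg.prod t (hx₀.trans ht.1)).hasDerivWithinAt)
        (fun _ _ => trivial) h0 ⟨hxx, le_rfl⟩
  exact ⟨congrArg Prod.fst key, congrArg Prod.snd key⟩

/-- Continuous dependence on the spectral parameter. -/
lemma continuous_param {q : ℝ → ℝ} {B : ℝ} (hB : ∀ x, |q x| ≤ B) {a b : ℝ} {F F' : ℝ → ℝ → ℝ}
    (hF : ∀ μ, IsSol q μ (F μ) (F' μ)) (h0 : ∀ μ, F μ 0 = a) (h0' : ∀ μ, F' μ 0 = b) {x : ℝ}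
    (hx : 0 ≤ x) : Continuous fun μ => (F μ x, F' μ x) := by
  have hB0 : 0 ≤ B := (abs_nonneg _).trans (hB 0)
  rw [continuous_iff_continuousAt]
  intro ν
  have hc (μ : ℝ) : ContinuousOn (fun x => (F μ x, F' μ x)) (Set.Icc 0 x) := fun y hy =>
    ((hF μ).prod y hy.1).continuousAt.continuousWithinAt
  obtain ⟨C, hC⟩ := isCompact_Icc.exists_bound_of_continuousOn (hc ν)
  have hC0 : 0 ≤ C := (norm_nonneg _).trans (hC 0 ⟨le_rfl, hx⟩)
  -- A Lipschitz constant common to all parameters within distance `1` of `ν`.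
  set K : ℝ := 1 + B + (|ν| + 1) with hK
  have hK0 : 0 < K := by positivity
  have hl (μ : ℝ) (hμ : |μ - ν| < 1) (t : ℝ) : LipschitzWith ⟨K, hK0.le⟩ (field q μ t) :=
    LipschitzWith.of_dist_le_mul fun p p' => by
      rw [dist_eq_norm, dist_eq_norm]
      refine (field_lipschitz hB μ t p p').trans ?_
      change _ ≤ K * _
      gcongr
      have := abs_sub_abs_le_abs_sub μ ν
      linarith
  have hd (μ : ℝ) (hμ : |μ - ν| < 1) :
      dist (F μ x, F' μ x) (F ν x, F' ν x) ≤ gronwallBound 0 K (0 + |μ - ν| * C) (x - 0) := by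
    have := dist_le_of_approx_trajectories_ODE (v := field q μ) (K := ⟨K, hK0.le⟩)
      (f := fun x => (F μ x, F' μ x)) (g := fun x => (F ν x, F' ν x))
      (f' := fun x => field q μ x (F μ x, F' μ x)) (g' := fun x => field q ν x (F ν x, F' ν x))
      (a := 0) (b := x) (εf := 0) (εg := |μ - ν| * C) (δ := 0)
      (fun t => hl μ hμ t) (hc μ) (fun t ht => ((hF μ).prod t ht.1).hasDerivWithinAt)
      (fun t _ => by simp) (hc ν) (fun t ht => ((hF ν).prod t ht.1).hasDerivWithinAt)
      -- The solution at `ν` is an approximate trajectory of the field at `μ` with error `|μ - ν|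
      -- C`, so Grönwall's bound tends to `0` with `μ - ν`.
      (fun t ht => by
        have e : field q ν t (F ν t, F' ν t) - field q μ t (F ν t, F' ν t) =
            (0, (μ - ν) * F ν t) := by
          simp only [field, Prod.mk_sub_mk, sub_self, Prod.mk.injEq, true_and]
          ring
        rw [dist_eq_norm, e, Prod.norm_def, norm_zero, norm_mul, Real.norm_eq_abs,
          max_eq_right (by positivity)]
        gcongr
        exact (norm_fst_le (F ν t, F' ν t)).trans (hC t ⟨ht.1, ht.2.le⟩))
      (by simp [h0, h0']) x ⟨hx, le_rfl⟩
    exact this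
  have hlim : Tendsto (fun μ => gronwallBound 0 K (0 + |μ - ν| * C) (x - 0)) (𝓝 ν) (𝓝 0) := by
    have h1 : Continuous fun μ => gronwallBound 0 K (0 + |μ - ν| * C) (x - 0) :=
      (gronwallBound_continuous_ε 0 K (x - 0)).comp (by fun_prop)
    have := h1.tendsto ν
    simpa [gronwallBound_ε0_δ0] using this
  have hnear : ∀ᶠ μ in 𝓝 ν, |μ - ν| < 1 := Metric.ball_mem_nhds ν one_pos
  refine tendsto_iff_dist_tendsto_zero.2 (squeeze_zero' (Eventually.of_forall fun _ =>
    dist_nonneg) ?_ hlim)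
  filter_upwards [hnear] with μ hμ using hd μ hμ

/-! ### Growth, decay and shooting on the half-line -/

section HalfLine

variable {q : ℝ → ℝ} {μ ν : ℝ} {f f' g g' : ℝ → ℝ}

lemma IsSol.zero (q : ℝ → ℝ) (μ : ℝ) : IsSol q μ (fun _ => 0) (fun _ => 0) :=
  ⟨fun x _ => hasDerivAt_const x 0, fun x _ => by simpa using hasDerivAt_const x (0 : ℝ)⟩

lemma IsSol.neg (h : IsSol q μ f f') : IsSol q μ (fun x => -f x) (fun x => -f' x) :=
  ⟨fun x hx => (h.deriv x hx).neg, fun x hx =>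
    (h.deriv' x hx).neg.congr_deriv (by ring)⟩

lemma IsSol.continuousOn (h : IsSol q μ f f') : ContinuousOn f (Set.Ici 0) := fun x hx =>
  (h.deriv x hx).continuousAt.continuousWithinAt

lemma IsSol.continuousOn' (h : IsSol q μ f f') : ContinuousOn f' (Set.Ici 0) := fun x hx =>
  (h.deriv' x hx).continuousAt.continuousWithinAt

lemma IsSol.hasDerivAt_mul (h : IsSol q μ f f') {x : ℝ} (hx : 0 ≤ x) :
    HasDerivAt (fun x => f x * f' x) (f' x ^ 2 + (q x - μ) * f x ^ 2) x :=
  ((h.deriv x hx).mul (h.deriv' x hx)).congr_deriv (by ring)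

lemma IsSol.ne_zero {B : ℝ} (hB : ∀ x, |q x| ≤ B) (h : IsSol q μ f f')
    (h0 : f 0 ≠ 0 ∨ f' 0 ≠ 0) {x : ℝ} (hx : 0 ≤ x) : f x ≠ 0 ∨ f' x ≠ 0 := by
  by_contra! hc
  have := h.unique hB (.zero q μ) hx hc.1 hc.2 le_rfl
  tauto

/-- The Wronskian identity. -/
lemma IsSol.hasDerivAt_wronskian (hf : IsSol q μ f f') (hg : IsSol q ν g g') {x : ℝ}
    (hx : 0 ≤ x) :
    HasDerivAt (fun x => f' x * g x - f x * g' x) ((ν - μ) * (f x * g x)) x :=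
  (((hf.deriv' x hx).mul (hg.deriv x hx)).sub
    ((hf.deriv x hx).mul (hg.deriv' x hx))).congr_deriv (by ring)

lemma IsSol.wronskian_eq (hf : IsSol q μ f f') (hg : IsSol q μ g g') {x : ℝ} (hx : 0 ≤ x) :
    f' x * g x - f x * g' x = f' 0 * g 0 - f 0 * g' 0 := by
  refine constant_of_has_deriv_right_zero (f := fun x => f' x * g x - f x * g' x) (a := 0)
    (b := x) (fun y hy => ?_) (fun y hy => ?_) x ⟨hx, le_rfl⟩
  · exact (hf.hasDerivAt_wronskian hg hy.1).continuousAt.continuousWithinAt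
  · simpa using (hf.hasDerivAt_wronskian hg hy.1).hasDerivWithinAt

/-- `f` decays at infinity: `(f²)' ≤ 0` from `Y` on. -/
def Decaying (Y : ℝ) (f f' : ℝ → ℝ) : Prop := ∀ y, Y ≤ y → f y * f' y ≤ 0

variable {Y c : ℝ}

/-- The derivative of `f f'` is `f'² + (q - μ) f²`. This is the source of the dichotomy: either `f
f'` stays nonpositive from `Y` on, or it becomes and remains positive. -/
lemma IsSol.monotoneOn_mul (hY : 0 ≤ Y) (hc : 0 ≤ c) (hq : ∀ y, Y ≤ y → c ≤ q y - μ)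
    (h : IsSol q μ f f') : MonotoneOn (fun x => f x * f' x) (Set.Ici Y) := by
  refine monotoneOn_of_hasDerivWithinAt_nonneg (convex_Ici Y) (fun x hx =>
    (h.hasDerivAt_mul (hY.trans hx)).continuousAt.continuousWithinAt) (fun x hx => ?_) ?_
    (f' := fun x => f' x ^ 2 + (q x - μ) * f x ^ 2)
  · rw [interior_Ici] at hx
    exact (h.hasDerivAt_mul (hY.trans (le_of_lt hx))).hasDerivWithinAt
  · intro x hx
    rw [interior_Ici] at hx
    have := hc.trans (hq x (le_of_lt hx))
    positivity

lemma MonotoneOn.exists_tendsto {k : ℝ → ℝ} {Y C : ℝ} (hk : MonotoneOn k (Set.Ici Y))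
    (hC : ∀ y, Y ≤ y → k y ≤ C) : ∃ l, Tendsto k atTop (𝓝 l) := by
  have hm : Monotone fun y => k (max y Y) := fun a b hab =>
    hk (Set.mem_Ici.2 (le_max_right _ _)) (Set.mem_Ici.2 (le_max_right _ _))
      (max_le_max hab le_rfl)
  have ht := tendsto_atTop_ciSup hm ⟨C, by rintro _ ⟨y, rfl⟩; exact hC _ (le_max_right _ _)⟩
  refine ⟨_, ht.congr' ?_⟩
  filter_upwards [eventually_ge_atTop Y] with y hy
  rw [max_eq_left hy]

lemma MonotoneOn.le_of_tendsto {k : ℝ → ℝ} {Y l : ℝ} (hk : MonotoneOn k (Set.Ici Y))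
    (hl : Tendsto k atTop (𝓝 l)) {y : ℝ} (hy : Y ≤ y) : k y ≤ l := by
  refine ge_of_tendsto hl ?_
  filter_upwards [eventually_ge_atTop y] with z hz
  exact hk hy (hy.trans hz) hz

/-- The product `f f'` increases and is bounded above by `0`, so its derivative `f'² + (q - μ) f²`
is integrable and dominates both squares up to a constant. -/
lemma Decaying.integrableOn (hY : 0 ≤ Y) (hc : 0 < c)
    (hq : ∀ y, Y ≤ y → c ≤ q y - μ) (h : IsSol q μ f f') (hd : Decaying Y f f') :
    IntegrableOn (fun x => f x ^ 2) (Set.Ioi 0) ∧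
      IntegrableOn (fun x => f' x ^ 2) (Set.Ioi 0) := by
  obtain ⟨l, hl⟩ := MonotoneOn.exists_tendsto (h.monotoneOn_mul hY hc.le hq) hd
  have hi : IntegrableOn (fun x => f' x ^ 2 + (q x - μ) * f x ^ 2) (Set.Ioi Y) := by
    refine integrableOn_Ioi_deriv_of_nonneg
      (h.hasDerivAt_mul hY).continuousAt.continuousWithinAt
      (fun x hx => h.hasDerivAt_mul (hY.trans (le_of_lt hx))) (fun x hx => ?_) hl
    have := hc.le.trans (hq x (le_of_lt hx))
    positivity
  have hsub : Set.Ioi Y ⊆ Set.Ici 0 := fun x hx => hY.trans (le_of_lt hx)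
  have hfin {k : ℝ → ℝ} (hk : ContinuousOn k (Set.Ici 0)) (hk' : IntegrableOn k (Set.Ioi Y)) :
      IntegrableOn k (Set.Ioi 0) := by
    have h1 : IntegrableOn k (Set.Icc 0 Y) :=
      (hk.mono Set.Icc_subset_Ici_self).integrableOn_Icc
    refine (h1.union hk').mono_set fun x hx => ?_
    rcases le_or_gt x Y with hxY | hxY
    · exact Or.inl ⟨le_of_lt hx, hxY⟩
    · exact Or.inr hxY
  have hf2 : ContinuousOn (fun x => f x ^ 2) (Set.Ici 0) := h.continuousOn.pow 2
  have hf2' : ContinuousOn (fun x => f' x ^ 2) (Set.Ici 0) := h.continuousOn'.pow 2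
  refine ⟨hfin hf2 ?_, hfin hf2' ?_⟩
  · refine (hi.const_mul c⁻¹).mono' ((hf2.mono hsub).aestronglyMeasurable measurableSet_Ioi) ?_
    filter_upwards [ae_restrict_mem measurableSet_Ioi] with x hx
    rw [Real.norm_of_nonneg (sq_nonneg _), ← div_eq_inv_mul, le_div_iff₀ hc]
    nlinarith [hq x (le_of_lt hx), sq_nonneg (f x), sq_nonneg (f' x)]
  · refine hi.mono' ((hf2'.mono hsub).aestronglyMeasurable measurableSet_Ioi) ?_
    filter_upwards [ae_restrict_mem measurableSet_Ioi] with x hx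
    rw [Real.norm_of_nonneg (sq_nonneg _)]
    nlinarith [hq x (le_of_lt hx), sq_nonneg (f x), sq_nonneg (f' x)]

/-- The functions `f²` and `f'²` are integrable together with their derivatives, which are bounded
multiples of `f f'`; such functions vanish at infinity. -/
lemma Decaying.tendsto {B : ℝ} (hB : ∀ x, |q x| ≤ B) (hqc : Continuous q) (hY : 0 ≤ Y)
    (hc : 0 < c) (hq : ∀ y, Y ≤ y → c ≤ q y - μ) (h : IsSol q μ f f')
    (hd : Decaying Y f f') : Tendsto f atTop (𝓝 0) ∧ Tendsto f' atTop (𝓝 0) := by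
  obtain ⟨h1, h2⟩ := hd.integrableOn hY hc hq h
  have hsub : Set.Ioi (0 : ℝ) ⊆ Set.Ici 0 := Set.Ioi_subset_Ici_self
  have hB0 : 0 ≤ B := (abs_nonneg _).trans (hB 0)
  have hmul {k : ℝ → ℝ} {C : ℝ} (hk : ContinuousOn k (Set.Ici 0)) (hC : ∀ x, |k x| ≤ C) :
      IntegrableOn (fun x => 2 * k x * (f x * f' x)) (Set.Ioi 0) := by
    refine ((h1.add h2).const_mul C).mono' (ContinuousOn.aestronglyMeasurable
      (((continuousOn_const.mul hk).mul (h.continuousOn.mul h.continuousOn')).mono hsub)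
      measurableSet_Ioi) ?_
    refine Eventually.of_forall fun x => ?_
    have hCx := hC x
    have hk0 := abs_nonneg (k x)
    have hff : 2 * |f x * f' x| ≤ f x ^ 2 + f' x ^ 2 := by
      rw [abs_mul, ← sq_abs (f x), ← sq_abs (f' x)]
      nlinarith [sq_nonneg (|f x| - |f' x|)]
    calc ‖2 * k x * (f x * f' x)‖ = |k x| * (2 * |f x * f' x|) := by
          rw [Real.norm_eq_abs, abs_mul, abs_mul, abs_two]; ring
      _ ≤ C * (f x ^ 2 + f' x ^ 2) := by gcongr; exact hk0.trans hCx
  have hsq {k : ℝ → ℝ} (hk : Tendsto (fun x => k x ^ 2) atTop (𝓝 0)) :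
      Tendsto k atTop (𝓝 0) := by
    have := hk.sqrt
    simp only [Real.sqrt_sq_eq_abs, Real.sqrt_zero] at this
    exact tendsto_zero_iff_abs_tendsto_zero k |>.2 this
  constructor
  · refine hsq (tendsto_zero_of_hasDerivAt_of_integrableOn_Ioi (a := 0) (fun x hx => ?_)
      (hmul (k := fun _ => 1) (C := 1) continuousOn_const (by simp)) h1)
    exact ((h.deriv x (le_of_lt hx)).pow 2).congr_deriv (by ring)
  · refine hsq (tendsto_zero_of_hasDerivAt_of_integrableOn_Ioi (a := 0) (fun x hx => ?_)
      (hmul (k := fun x => q x - μ) (C := B + |μ|) (by fun_prop) (fun x =>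
        (abs_sub _ _).trans (by gcongr; exact hB x))) h2)
    exact ((h.deriv' x (le_of_lt hx)).pow 2).congr_deriv (by ring)

/-- If `f f'` is positive at some `y`, it stays positive, so `f²` stays above the positive constant
`f(y)²` and is not integrable. -/
lemma IsSol.decaying_of_integrableOn (hY : 0 ≤ Y) (hc : 0 ≤ c)
    (hq : ∀ y, Y ≤ y → c ≤ q y - μ) (h : IsSol q μ f f')
    (hi : IntegrableOn (fun x => f x ^ 2) (Set.Ioi 0)) : Decaying Y f f' := by
  intro y hy
  by_contra! hpos
  have hm := h.monotoneOn_mul hY hc hq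
  have hmono : MonotoneOn (fun x => f x ^ 2) (Set.Ici y) := by
    refine monotoneOn_of_hasDerivWithinAt_nonneg (convex_Ici y) (fun x hx =>
      (((h.deriv x (hY.trans (hy.trans hx)))).pow 2).continuousAt.continuousWithinAt)
      (f' := fun x => 2 * (f x * f' x)) (fun x hx => ?_) ?_
    · rw [interior_Ici] at hx
      exact (((h.deriv x (hY.trans (hy.trans (le_of_lt hx)))).pow 2).congr_deriv
        (by ring)).hasDerivWithinAt
    · intro x hx
      rw [interior_Ici] at hx
      have := hm hy (hy.trans (le_of_lt hx)) (le_of_lt hx)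
      simp only at this
      linarith
  have hconst : IntegrableOn (fun _ : ℝ => f y ^ 2) (Set.Ioi y) := by
    refine (hi.mono_set (Set.Ioi_subset_Ioi (hY.trans hy))).mono'
      aestronglyMeasurable_const ?_
    filter_upwards [ae_restrict_mem measurableSet_Ioi] with x hx
    rw [Real.norm_of_nonneg (sq_nonneg _)]
    exact hmono (Set.mem_Ici.2 le_rfl) (Set.mem_Ici.2 (le_of_lt hx)) (le_of_lt hx)
  rw [integrableOn_const_iff] at hconst
  simp only [Real.volume_Ioi, lt_self_iff_false, or_false, enorm_eq_zero] at hconst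
  simp [pow_eq_zero_iff] at hconst
  simp [hconst] at hpos

/-- Growth with a given sign persists: `f f'` cannot return to `0`, so `f` cannot change sign. -/
lemma IsSol.pos_of_pos (hY : 0 ≤ Y) (hc : 0 ≤ c) (hq : ∀ y, Y ≤ y → c ≤ q y - μ)
    (h : IsSol q μ f f') {y : ℝ} (hy : Y ≤ y) (hf : 0 < f y) (hf' : 0 < f' y) {t : ℝ}
    (ht : y ≤ t) : 0 < f t ∧ 0 < f' t := by
  have hpos : ∀ s, y ≤ s → 0 < f s * f' s := fun s hs =>
    (mul_pos hf hf').trans_le (h.monotoneOn_mul hY hc hq hy (hy.trans hs) hs)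
  have hft : 0 < f t := by
    by_contra! hle
    obtain ⟨s, hs, hs0⟩ := intermediate_value_Icc' ht
      (h.continuousOn.mono fun s hs => hY.trans (hy.trans hs.1)) ⟨hle, hf.le⟩
    have := hpos s hs.1
    simp [hs0] at this
  exact ⟨hft, pos_of_mul_pos_right (hpos t ht) hft.le⟩

/-- For very negative `μ` the solution eventually grows. -/
lemma IsSol.exists_growing {B : ℝ} (hB : ∀ x, |q x| ≤ B) (hqc : Continuous q) (hY : 0 ≤ Y)
    {M : ℝ} (hμ : μ = -(B + M ^ 2 + 1)) (h : IsSol q μ f f') (h0 : 0 ≤ f 0)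
    (h0' : 0 < f' 0 + M * f 0) : ∃ y, Y ≤ y ∧ 0 < f y ∧ 0 < f' y := by
  have hqμ (x : ℝ) : M ^ 2 + 1 ≤ q x - μ := by
    have := (abs_le.1 (hB x)).1
    linarith
  have hne (x : ℝ) (hx : 0 ≤ x) : f x ≠ 0 ∨ f' x ≠ 0 := h.ne_zero hB (by
    by_contra! hc
    simp [hc] at h0') hx
  -- The term `M f` absorbs a possibly negative initial slope, so that this product starts
  -- nonnegative; the choice of `μ` makes its derivative positive.
  have hder (x : ℝ) (hx : 0 ≤ x) : HasDerivAt (fun x => f x * (f' x + M * f x))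
      ((f' x + M * f x) ^ 2 + (q x - μ - M ^ 2) * f x ^ 2) x :=
    ((h.deriv x hx).mul ((h.deriv' x hx).add ((h.deriv x hx).const_mul M))).congr_deriv (by
      simp only [Pi.add_apply]
      ring)
  have hmono : StrictMonoOn (fun x => f x * (f' x + M * f x)) (Set.Ici 0) := by
    refine strictMonoOn_of_hasDerivWithinAt_pos (convex_Ici 0) (fun x hx =>
      (hder x hx).continuousAt.continuousWithinAt) (fun x hx => ?_) (fun x hx => ?_)
      (f' := fun x => (f' x + M * f x) ^ 2 + (q x - μ - M ^ 2) * f x ^ 2)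
    · rw [interior_Ici] at hx
      exact (hder x (le_of_lt hx)).hasDerivWithinAt
    · rw [interior_Ici] at hx
      have h1 : f x ^ 2 ≤ (q x - μ - M ^ 2) * f x ^ 2 := by
        nlinarith [hqμ x, sq_nonneg (f x)]
      rcases eq_or_ne (f x) 0 with hfx | hfx
      · have := (hne x (le_of_lt hx)).resolve_left (by simp [hfx])
        have : 0 < f' x ^ 2 := by positivity
        simp only [hfx]
        linarith
      · have : 0 < f x ^ 2 := by positivity
        have := sq_nonneg (f' x + M * f x)
        linarith
  have hp (x : ℝ) (hx : 0 < x) : 0 < f x * (f' x + M * f x) :=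
    (mul_nonneg h0 h0'.le).trans_lt (hmono (Set.mem_Ici.2 le_rfl) hx.le hx)
  have hh (x : ℝ) (hx : 0 ≤ x) : 0 < f' x + M * f x := by
    by_contra! hle
    obtain ⟨s, hs, hs0⟩ := intermediate_value_Icc' (f := fun x => f' x + M * f x) hx
      ((h.continuousOn'.add (continuousOn_const.mul h.continuousOn)).mono
        Set.Icc_subset_Ici_self) ⟨hle, h0'.le⟩
    simp only at hs0
    rcases hs.1.eq_or_lt with rfl | hs1
    · linarith
    · have := hp s hs1
      simp [hs0] at this
  have hf (x : ℝ) (hx : 0 < x) : 0 < f x := pos_of_mul_pos_left (hp x hx) (hh x hx.le).le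
  -- Since `f > 0` on `(0, ∞)`, absence of growth means decay. Then the strictly increasing product
  -- tends to `0`, although it is already positive.
  by_contra! hno
  have hdec : Decaying (max Y 1) f f' := fun y hy => by
    have hy1 : 0 < y := one_pos.trans_le ((le_max_right _ _).trans hy)
    exact mul_nonpos_of_nonneg_of_nonpos (hf y hy1).le
      (hno y ((le_max_left _ _).trans hy) (hf y hy1))
  obtain ⟨t1, t2⟩ := hdec.tendsto hB hqc (hY.trans (le_max_left _ _)) (c := M ^ 2 + 1)
    (by positivity) (fun y _ => hqμ y) h
  have t3 : Tendsto (fun x => f x * (f' x + M * f x)) atTop (𝓝 0) := by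
    simpa using t1.mul (t2.add (t1.const_mul M))
  have := MonotoneOn.le_of_tendsto hmono.monotoneOn t3 (y := 1) (by norm_num)
  exact absurd (hp 1 one_pos) (not_lt.2 this)

/-- A shooting argument: the family of solutions with initial data `(a, b)` contains a decaying
one at a negative spectral parameter, as soon as the solution at zero energy turns negative. -/
lemma exists_decaying {B : ℝ} (hB : ∀ x, |q x| ≤ B) (hqc : Continuous q) (hY : 0 ≤ Y)
    (hc : 0 < c) (hq : ∀ y, Y ≤ y → c ≤ q y) {ψ ψ' : ℝ → ℝ} (hψ : IsSol q 0 ψ ψ')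
    (hψneg : ∀ᶠ y in atTop, ψ y < 0) (hψ0 : Tendsto ψ atTop (𝓝 0))
    (hψ0' : Tendsto ψ' atTop (𝓝 0)) {a b M : ℝ} (ha : 0 ≤ a) (hM : 0 < b + M * a)
    (hw : 0 < b * ψ 0 - a * ψ' 0) {F F' : ℝ → ℝ → ℝ} (hF : ∀ μ, IsSol q μ (F μ) (F' μ))
    (h0 : ∀ μ, F μ 0 = a) (h0' : ∀ μ, F' μ 0 = b) : ∃ μ < 0, Decaying Y (F μ) (F' μ) := by
  have hqμ {μ : ℝ} (hμ : μ ≤ 0) (y : ℝ) (hy : Y ≤ y) : c ≤ q y - μ := by linarith [hq y hy]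
  by_contra! hno
  have hcont (y : ℝ) (hy : 0 ≤ y) := continuous_param hB hF h0 h0' hy
  -- Growth is witnessed at a single point, so continuity in `μ` makes `P` and `N` open.
  set P : Set ℝ := {μ | ∃ y, Y ≤ y ∧ 0 < F μ y ∧ 0 < F' μ y} with hP
  set N : Set ℝ := {μ | ∃ y, Y ≤ y ∧ F μ y < 0 ∧ F' μ y < 0} with hN
  have hPo : IsOpen P := by
    have : P = ⋃ y, ⋃ (_ : Y ≤ y), (fun μ => (F μ y, F' μ y)) ⁻¹' (Set.Ioi 0 ×ˢ Set.Ioi 0) := by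
      ext; simp [hP, and_left_comm]
    rw [this]
    exact isOpen_iUnion fun y => isOpen_iUnion fun hy =>
      (isOpen_Ioi.prod isOpen_Ioi).preimage (hcont y (hY.trans hy))
  have hNo : IsOpen N := by
    have : N = ⋃ y, ⋃ (_ : Y ≤ y), (fun μ => (F μ y, F' μ y)) ⁻¹' (Set.Iio 0 ×ˢ Set.Iio 0) := by
      ext; simp [hN, and_left_comm]
    rw [this]
    exact isOpen_iUnion fun y => isOpen_iUnion fun hy =>
      (isOpen_Iio.prod isOpen_Iio).preimage (hcont y (hY.trans hy))
  have hndec {μ : ℝ} (hn : ¬ Decaying Y (F μ) (F' μ)) : μ ∈ P ∪ N := by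
    unfold Decaying at hn
    push Not at hn
    obtain ⟨y, hy, hpos⟩ := hn
    rcases pos_and_pos_or_neg_and_neg_of_mul_pos hpos with h | h
    · exact Or.inl ⟨y, hy, h⟩
    · exact Or.inr ⟨y, hy, h⟩
  have hdisj {μ : ℝ} (hμ : μ ≤ 0) : ¬ (μ ∈ P ∧ μ ∈ N) := by
    rintro ⟨⟨y, hy, h1, h2⟩, z, hz, h3, h4⟩
    have e1 := (hF μ).pos_of_pos hY hc.le (hqμ hμ) hy h1 h2 (le_max_left y z)
    have e2 := (hF μ).neg.pos_of_pos hY hc.le (hqμ hμ) hz (neg_pos.2 h3) (neg_pos.2 h4)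
      (le_max_right y z)
    linarith [e1.1, e2.1]
  have hwr (x : ℝ) (hx : 0 ≤ x) : F' 0 x * ψ x - F 0 x * ψ' x = b * ψ 0 - a * ψ' 0 := by
    rw [(hF 0).wronskian_eq hψ hx, h0, h0']
  have hψψ : ∀ y, Y ≤ y → ψ y * ψ' y ≤ 0 := fun y hy =>
    MonotoneOn.le_of_tendsto (hψ.monotoneOn_mul hY hc.le (hqμ le_rfl))
      (by simpa using hψ0.mul hψ0') hy
  -- The Wronskian of `F 0` with `ψ` is a positive constant. Decay would make it tend to `0`;
  -- positive growth would make it negative at a point where `ψ < 0 ≤ ψ'`.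
  have hzero : (0 : ℝ) ∈ N := by
    have hnd : ¬ Decaying Y (F 0) (F' 0) := by
      intro hd
      obtain ⟨t1, t2⟩ := hd.tendsto hB hqc hY hc (hqμ le_rfl) (hF 0)
      have t3 : Tendsto (fun x => F' 0 x * ψ x - F 0 x * ψ' x) atTop (𝓝 0) := by
        simpa using (t2.mul hψ0).sub (t1.mul hψ0')
      have t4 : Tendsto (fun x => F' 0 x * ψ x - F 0 x * ψ' x) atTop
          (𝓝 (b * ψ 0 - a * ψ' 0)) := by
        refine tendsto_const_nhds.congr' ?_
        filter_upwards [eventually_ge_atTop 0] with x hx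
        exact (hwr x hx).symm
      exact hw.ne (tendsto_nhds_unique t3 t4)
    refine (hndec hnd).resolve_left ?_
    rintro ⟨y, hy, h1, h2⟩
    obtain ⟨z, hz1, hz2⟩ := (hψneg.and (eventually_ge_atTop y)).exists
    obtain ⟨e1, e2⟩ := (hF 0).pos_of_pos hY hc.le (hqμ le_rfl) hy h1 h2 hz2
    have e3 : 0 ≤ ψ' z := by
      by_contra! hneg
      exact absurd (hψψ z (hy.trans hz2)) (not_le.2 (mul_pos_of_neg_of_neg hz1 hneg))
    have e4 := hwr z (hY.trans (hy.trans hz2))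
    nlinarith [mul_nonneg e1.le e3, mul_pos e2 (neg_pos.2 hz1)]
  have hbot : -(B + M ^ 2 + 1) ∈ P := (hF _).exists_growing hB hqc hY rfl (by rw [h0]; exact ha)
    (by rw [h0, h0']; exact hM)
  have hbot0 : -(B + M ^ 2 + 1) ≤ 0 := by
    have : 0 ≤ B := (abs_nonneg _).trans (hB 0)
    nlinarith [sq_nonneg M]
  -- Without a decaying solution `P` and `N` would disconnect `(-∞, 0]`.
  obtain ⟨μ, hμ, hμ'⟩ := isPreconnected_Iic (a := (0 : ℝ)) P N hPo hNo (fun μ hμ => by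
      rcases (Set.mem_Iic.1 hμ).eq_or_lt with rfl | hlt
      · exact Or.inr hzero
      · exact hndec (hno μ hlt))
    ⟨_, hbot0, hbot⟩ ⟨0, Set.mem_Iic.2 le_rfl, hzero⟩
  exact hdisj hμ hμ'

end HalfLine

/-! ### Jacobi's comparison with the zero-energy solution -/

section Uniqueness

variable {q : ℝ → ℝ} {μ ν Y c B : ℝ} {f f' g g' ψ ψ' : ℝ → ℝ}

/-- A decaying positive-energy tail controls its derivative. -/
lemma IsSol.sq_deriv_le (hB : ∀ x, |q x| ≤ B) (hY : 0 ≤ Y) (hc : 0 ≤ c)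
    (hq : ∀ y, Y ≤ y → c ≤ q y) (hψ : IsSol q 0 ψ ψ') (hψ0 : Tendsto ψ atTop (𝓝 0))
    (hψ0' : Tendsto ψ' atTop (𝓝 0)) {y : ℝ} (hy : Y ≤ y) : ψ' y ^ 2 ≤ B * ψ y ^ 2 := by
  have hψψ : ∀ y, Y ≤ y → ψ y * ψ' y ≤ 0 := fun y hy =>
    MonotoneOn.le_of_tendsto (hψ.monotoneOn_mul hY hc (fun y hy => by linarith [hq y hy]))
      (by simpa using hψ0.mul hψ0') hy
  -- Both `q - B` and `ψ ψ'` are nonpositive on the tail, so this difference increases to its limit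
  -- `0`.
  have hder (x : ℝ) (hx : 0 ≤ x) : HasDerivAt (fun x => ψ' x ^ 2 - B * ψ x ^ 2)
      (2 * ((q x - B) * (ψ x * ψ' x))) x :=
    (((hψ.deriv' x hx).pow 2).sub (((hψ.deriv x hx).pow 2).const_mul B)).congr_deriv (by ring)
  have hmono : MonotoneOn (fun x => ψ' x ^ 2 - B * ψ x ^ 2) (Set.Ici Y) := by
    refine monotoneOn_of_hasDerivWithinAt_nonneg (convex_Ici Y) (fun x hx =>
      (hder x (hY.trans hx)).continuousAt.continuousWithinAt) (fun x hx => ?_) (fun x hx => ?_)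
      (f' := fun x => 2 * ((q x - B) * (ψ x * ψ' x)))
    · rw [interior_Ici] at hx
      exact (hder x (hY.trans (le_of_lt hx))).hasDerivWithinAt
    · rw [interior_Ici] at hx
      have h1 := hψψ x (le_of_lt hx)
      have h2 : q x - B ≤ 0 := by linarith [(abs_le.1 (hB x)).2]
      have := mul_nonneg_of_nonpos_of_nonpos h2 h1
      positivity
  have hlim : Tendsto (fun x => ψ' x ^ 2 - B * ψ x ^ 2) atTop (𝓝 0) := by
    simpa using (hψ0'.pow 2).sub ((hψ0.pow 2).const_mul B)
  have := MonotoneOn.le_of_tendsto hmono hlim hy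
  linarith

/-- Jacobi's boundary functional `h h' - (ψ' / ψ) h²` plus a multiple of the Wronskian, for
`h = a f + b g`. -/
noncomputable def jacobi (ψ ψ' f f' g g' : ℝ → ℝ) (a b k x : ℝ) : ℝ :=
  (a * f x + b * g x) * (a * f' x + b * g' x) - ψ' x / ψ x * (a * f x + b * g x) ^ 2 +
    k * (f' x * g x - f x * g' x)

variable {a b k : ℝ}

/-- With `h = a f + b g`, subtracting the derivative of `(ψ'/ψ) h²` from `h'² + q h²` leaves the
square `(h' - (ψ'/ψ) h)²`. The remaining cross term `-(μ + ν) a b f g` is cancelled by the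
Wronskian; this fixes `k`. -/
lemma hasDerivAt_jacobi (hψ : IsSol q 0 ψ ψ') (hf : IsSol q μ f f') (hg : IsSol q ν g g')
    (hk : k * (ν - μ) = a * b * (μ + ν)) {x : ℝ} (hx : 0 ≤ x) (hψx : ψ x ≠ 0) :
    HasDerivAt (jacobi ψ ψ' f f' g g' a b k)
      ((a * f' x + b * g' x - ψ' x / ψ x * (a * f x + b * g x)) ^ 2 +
        (-μ) * (a * f x) ^ 2 + (-ν) * (b * g x) ^ 2) x := by
  have h1 := ((hf.deriv x hx).const_mul a).add ((hg.deriv x hx).const_mul b)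
  have h2 := ((hf.deriv' x hx).const_mul a).add ((hg.deriv' x hx).const_mul b)
  have h3 := (hψ.deriv' x hx).div (hψ.deriv x hx) hψx
  have h4 := (hf.hasDerivAt_wronskian hg hx).const_mul k
  refine (((h1.mul h2).sub (h3.mul (h1.pow 2))).add h4).congr_deriv ?_
  simp only [Pi.add_apply, Pi.pow_apply, Pi.div_apply]
  rw [← mul_assoc k, hk]
  field_simp
  ring

/-- A zero of `ψ` is simple, so where `h` vanishes too, `h/ψ` has a finite limit (a quotient of
slopes) and `(ψ'/ψ) h²` tends to `0`. -/
lemma continuousAt_jacobi (hψ : IsSol q 0 ψ ψ') (hf : IsSol q μ f f') (hg : IsSol q ν g g')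
    {x : ℝ} (hx : 0 ≤ x) (hψx : ψ x ≠ 0 ∨ ψ' x ≠ 0) (hh : a * f x + b * g x = 0) :
    ContinuousAt (jacobi ψ ψ' f f' g g' a b k) x := by
  have h1 := ((hf.deriv x hx).const_mul a).add ((hg.deriv x hx).const_mul b)
  have h2 := (((hf.deriv' x hx).const_mul a).add ((hg.deriv' x hx).const_mul b)).continuousAt
  have h4 := ((hf.hasDerivAt_wronskian hg hx).const_mul k).continuousAt
  have hψc := (hψ.deriv' x hx).continuousAt
  have key : ContinuousAt (fun y => ψ' y / ψ y * (a * f y + b * g y) ^ 2) x := by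
    rcases eq_or_ne (ψ x) 0 with hz | hnz
    · have hz' := hψx.resolve_left (by simp [hz])
      have hs := (hasDerivAt_iff_tendsto_slope.1 h1).div
        (hasDerivAt_iff_tendsto_slope.1 (hψ.deriv x hx)) hz'
      have ht : Tendsto (fun y => ψ' y * (a * f y + b * g y) *
          ((a * f y + b * g y) / ψ y)) (𝓝[≠] x) (𝓝 0) := by
        have hlim : Tendsto (fun y => ψ' y * (a * f y + b * g y)) (𝓝[≠] x) (𝓝 0) := by
          have : Tendsto (fun y => ψ' y * (a * f y + b * g y)) (𝓝 x)
              (𝓝 (ψ' x * (a * f x + b * g x))) := hψc.mul h1.continuousAt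
          rw [hh, mul_zero] at this
          exact this.mono_left nhdsWithin_le_nhds
        have := hlim.mul hs
        rw [zero_mul] at this
        refine this.congr' ?_
        filter_upwards [self_mem_nhdsWithin] with y hy
        have hyx : y - x ≠ 0 := sub_ne_zero.2 hy
        simp only [Pi.div_apply, slope_def_field, Pi.add_apply, hh, hz, sub_zero]
        rw [div_div_div_cancel_right₀ hyx]
      rw [continuousAt_iff_punctured_nhds, hh]
      simp only [ne_eq, OfNat.ofNat_ne_zero, not_false_eq_true, zero_pow, mul_zero]
      refine ht.congr fun y => ?_
      ring
    · exact (hψc.div (hψ.deriv x hx).continuousAt hnz).mul (h1.continuousAt.pow 2)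
  exact ((h1.continuousAt.mul h2).sub key).add h4

/-- A Jacobi-type comparison: two decaying solutions at negative spectral parameters have no
combination vanishing at the last zero of `ψ` with admissible boundary behaviour at `0`. -/
theorem no_combination (hB : ∀ x, |q x| ≤ B) (hqc : Continuous q) (hY : 0 ≤ Y) (hc : 0 < c)
    (hq : ∀ y, Y ≤ y → c ≤ q y) (hψ : IsSol q 0 ψ ψ') (hψ0 : Tendsto ψ atTop (𝓝 0))
    (hψ0' : Tendsto ψ' atTop (𝓝 0)) (hψne : ψ 0 ≠ 0) {x₀ : ℝ} (hx₀ : 0 ≤ x₀)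
    (hψx : ∀ x, 0 ≤ x → x ≠ x₀ → ψ x ≠ 0) (hμ : μ < 0) (hν : ν < 0) (hf : IsSol q μ f f')
    (hg : IsSol q ν g g') (hfd : Decaying Y f f') (hgd : Decaying Y g g')
    (hf0 : f 0 ≠ 0 ∨ f' 0 ≠ 0) (ha : a ≠ 0) (hh : a * f x₀ + b * g x₀ = 0)
    (hk : k * (ν - μ) = a * b * (μ + ν)) (hbd : 0 ≤ jacobi ψ ψ' f f' g g' a b k 0) : False := by
  have hqμ {μ : ℝ} (hμ : μ < 0) (y : ℝ) (hy : Y ≤ y) : c ≤ q y - μ := by linarith [hq y hy]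
  have hψn (x : ℝ) (hx : 0 ≤ x) := hψ.ne_zero hB (.inl hψne) hx
  set K := jacobi ψ ψ' f f' g g' a b k with hK
  set K' : ℝ → ℝ := fun x => (a * f' x + b * g' x - ψ' x / ψ x * (a * f x + b * g x)) ^ 2 +
        (-μ) * (a * f x) ^ 2 + (-ν) * (b * g x) ^ 2 with hK'
  have hder (x : ℝ) (hx : 0 ≤ x) (hxx : x ≠ x₀) : HasDerivAt K (K' x) x :=
    hasDerivAt_jacobi hψ hf hg hk hx (hψx x hx hxx)
  have hcont (x : ℝ) (hx : 0 ≤ x) : ContinuousAt K x := by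
    rcases eq_or_ne x x₀ with rfl | hne
    · exact continuousAt_jacobi hψ hf hg hx (hψn x hx) hh
    · exact (hder x hx hne).continuousAt
  have hK'0 (x : ℝ) : 0 ≤ K' x := by
    have h1 : 0 ≤ -μ := by linarith
    have h2 : 0 ≤ -ν := by linarith
    positivity
  -- The derivative of `K` is not available at `x₀`; continuity there joins the two monotone pieces.
  have hleft : MonotoneOn K (Set.Icc 0 x₀) := by
    refine monotoneOn_of_hasDerivWithinAt_nonneg (convex_Icc 0 x₀) (fun x hx =>
      (hcont x hx.1).continuousWithinAt) (fun x hx => ?_) (fun x _ => hK'0 x)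
    rw [interior_Icc] at hx
    exact (hder x hx.1.le hx.2.ne).hasDerivWithinAt
  have hright : MonotoneOn K (Set.Ici x₀) := by
    refine monotoneOn_of_hasDerivWithinAt_nonneg (convex_Ici x₀) (fun x hx =>
      (hcont x (hx₀.trans hx)).continuousWithinAt) (fun x hx => ?_) (fun x _ => hK'0 x)
    rw [interior_Ici] at hx
    exact (hder x (hx₀.trans (le_of_lt hx)) (ne_of_gt hx)).hasDerivWithinAt
  obtain ⟨f1, f2⟩ := hfd.tendsto hB hqc hY hc (hqμ hμ) hf
  obtain ⟨g1, g2⟩ := hgd.tendsto hB hqc hY hc (hqμ hν) hg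
  have hlim : Tendsto K atTop (𝓝 0) := by
    have e1 : Tendsto (fun x => a * f x + b * g x) atTop (𝓝 0) := by
      simpa using (f1.const_mul a).add (g1.const_mul b)
    have e2 : Tendsto (fun x => a * f' x + b * g' x) atTop (𝓝 0) := by
      simpa using (f2.const_mul a).add (g2.const_mul b)
    -- On the tail `|ψ'/ψ| ≤ √B`.
    have e3 : Tendsto (fun x => ψ' x / ψ x * (a * f x + b * g x) ^ 2) atTop (𝓝 0) := by
      have : Tendsto (fun x => √B * (a * f x + b * g x) ^ 2) atTop (𝓝 0) := by
        simpa using (e1.pow 2).const_mul √B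
      refine squeeze_zero_norm' ?_ this
      filter_upwards [eventually_ge_atTop Y] with x hx
      rw [norm_mul, Real.norm_of_nonneg (sq_nonneg _)]
      gcongr
      refine Real.le_sqrt_of_sq_le ?_
      rw [Real.norm_eq_abs, sq_abs, div_pow]
      have hB0 : 0 ≤ B := (abs_nonneg _).trans (hB 0)
      exact div_le_of_le_mul₀ (sq_nonneg _) hB0 (hψ.sq_deriv_le hB hY hc.le hq hψ0 hψ0' hx)
    have e4 : Tendsto (fun x => k * (f' x * g x - f x * g' x)) atTop (𝓝 0) := by
      simpa using ((f2.mul g1).sub (f1.mul g2)).const_mul k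
    have := ((e1.mul e2).sub e3).add e4
    simp only [mul_zero, sub_zero, add_zero] at this
    exact this
  have hKx₀ : 0 ≤ K x₀ := hbd.trans (hleft ⟨le_rfl, hx₀⟩ ⟨hx₀, le_rfl⟩ hx₀)
  -- `K` is nonnegative at `x₀`, increasing, and tends to `0`. Its derivative then vanishes beyond
  -- `x₀`, and the term `-μ (a f)²` forces `f = 0` there.
  have hKz (x : ℝ) (hx : x₀ ≤ x) : K x = 0 :=
    le_antisymm (MonotoneOn.le_of_tendsto hright hlim hx)
      (hKx₀.trans (hright (Set.mem_Ici.2 le_rfl) hx hx))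
  have hfz (x : ℝ) (hx : x₀ < x) : f x = 0 := by
    have hx0 : 0 ≤ x := hx₀.trans hx.le
    have h1 : HasDerivAt K 0 x := by
      refine (hasDerivAt_const x (0 : ℝ)).congr_of_eventuallyEq ?_
      filter_upwards [Ioi_mem_nhds hx] with y hy using hKz y (le_of_lt hy)
    have h2 : K' x = 0 := (hder x hx0 hx.ne').unique h1
    have h3 : 0 ≤ -ν * (b * g x) ^ 2 := mul_nonneg (by linarith) (sq_nonneg _)
    have h4 : -μ * (a * f x) ^ 2 = 0 := le_antisymm (by
      simp only [hK'] at h2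
      nlinarith [sq_nonneg (a * f' x + b * g' x - ψ' x / ψ x * (a * f x + b * g x))])
      (mul_nonneg (by linarith) (sq_nonneg _))
    simpa [hμ.ne, ha] using h4
  have hfz' : f' (x₀ + 1) = 0 := by
    refine (hf.deriv (x₀ + 1) (by linarith)).unique
      ((hasDerivAt_const (x₀ + 1) (0 : ℝ)).congr_of_eventuallyEq ?_)
    filter_upwards [Ioi_mem_nhds (lt_add_one x₀)] with y hy using hfz y hy
  rcases hf.ne_zero hB hf0 (x := x₀ + 1) (by linarith) with h | h
  · exact h (hfz _ (lt_add_one x₀))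
  · exact h hfz'

/-- For boundary data `(s, t)` compatible with `ψ`, at most one negative spectral parameter has a
decaying solution. -/
lemma decaying_unique (hB : ∀ x, |q x| ≤ B) (hqc : Continuous q) (hY : 0 ≤ Y) (hc : 0 < c)
    (hq : ∀ y, Y ≤ y → c ≤ q y) (hψ : IsSol q 0 ψ ψ') (hψ0 : Tendsto ψ atTop (𝓝 0))
    (hψ0' : Tendsto ψ' atTop (𝓝 0)) (hψne : ψ 0 ≠ 0) {x₀ : ℝ} (hx₀ : 0 ≤ x₀)
    (hψx : ∀ x, 0 ≤ x → x ≠ x₀ → ψ x ≠ 0) (hμ : μ < 0) (hν : ν < 0) (hf : IsSol q μ f f')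
    (hg : IsSol q ν g g') (hfd : Decaying Y f f') (hgd : Decaying Y g g')
    {s t : ℝ} (hst : s ≠ 0 ∨ t ≠ 0) (hfs : f 0 = s) (hft : f' 0 = t) (hgs : g 0 = s)
    (hgt : g' 0 = t) (hbd : x₀ = 0 ∨ ψ' 0 / ψ 0 * s ^ 2 ≤ s * t) : μ = ν := by
  by_contra hne
  -- The value at `0` is `(a + b)² (s t - (ψ'(0)/ψ(0)) s²)`, or `0` when `x₀ = 0`, where `h(0) = 0`.
  -- The factor `b` in the hypotheses on `g` admits `g = 0` with `b = 0`.
  have hJ {f f' g g' : ℝ → ℝ} {a b k : ℝ} (hW : f' 0 * g 0 - f 0 * g' 0 = 0)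
      (hfs : f 0 = s) (hft : f' 0 = t) (hgs : b * g 0 = b * s) (hgt : b * g' 0 = b * t)
      (hh : a * f x₀ + b * g x₀ = 0) : 0 ≤ jacobi ψ ψ' f f' g g' a b k 0 := by
    unfold jacobi
    rw [hW, mul_zero, add_zero]
    rcases hbd with h | h
    · rw [h] at hh
      rw [hh]
      simp
    · rw [hfs, hft, hgs, hgt]
      nlinarith [mul_nonneg (sq_nonneg (a + b)) (sub_nonneg.2 h)]
  -- If `g` vanishes at `x₀` it is a forbidden combination by itself; otherwise the coefficients
  -- `g(x₀)` and `-f(x₀)` give one with nonzero first coefficient.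
  rcases eq_or_ne (g x₀) 0 with hgx | hgx
  · exact no_combination hB hqc hY hc hq hψ hψ0 hψ0' hψne hx₀ hψx hν hν hg (.zero q ν) hgd
      (fun _ _ => by simp) (by rw [hgs, hgt]; exact hst) one_ne_zero (b := 0) (k := 0)
      (by simp [hgx]) (by simp)
      (hJ (by simp) hgs hgt (by simp) (by simp) (by simp [hgx]))
  · have hνμ : ν - μ ≠ 0 := sub_ne_zero.2 (Ne.symm hne)
    exact no_combination hB hqc hY hc hq hψ hψ0 hψ0' hψne hx₀ hψx hμ hν hf hg hfd hgd
      (by rw [hfs, hft]; exact hst) hgx (b := -f x₀)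
      (k := g x₀ * -f x₀ * (μ + ν) / (ν - μ)) (by ring) (by field_simp)
      (hJ (by rw [hfs, hft, hgs, hgt]; ring) hfs hft (by rw [hgs]) (by rw [hgt]) (by ring))

/-- When `ψ` has no zero, the point `x₀` is free; taking it to be `0` turns the Dirichlet condition
into the vanishing required of the combination. -/
lemma not_decaying_of_eq_zero (hB : ∀ x, |q x| ≤ B) (hqc : Continuous q) (hY : 0 ≤ Y)
    (hc : 0 < c) (hq : ∀ y, Y ≤ y → c ≤ q y) (hψ : IsSol q 0 ψ ψ')
    (hψ0 : Tendsto ψ atTop (𝓝 0)) (hψ0' : Tendsto ψ' atTop (𝓝 0))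
    (hψx : ∀ x, 0 ≤ x → ψ x ≠ 0) (hμ : μ < 0) (hf : IsSol q μ f f') (h0 : f 0 = 0)
    (h0' : f' 0 ≠ 0) : ¬ Decaying Y f f' := fun hfd =>
  no_combination hB hqc hY hc hq hψ hψ0 hψ0' (hψx 0 le_rfl) le_rfl (fun x hx _ => hψx x hx) hμ hμ
    hf (.zero q μ) hfd (fun _ _ => by simp) (.inr h0') one_ne_zero (b := 0) (k := 0)
    (by simp [h0]) (by simp) (by simp [jacobi, h0])

/-- At a given spectral parameter at most one solution up to scalars decays. -/
lemma not_both_decaying (hB : ∀ x, |q x| ≤ B) (hqc : Continuous q) (hY : 0 ≤ Y)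
    (hc : 0 < c) (hq : ∀ y, Y ≤ y → c ≤ q y - μ) (hf : IsSol q μ f f') (hg : IsSol q μ g g')
    (hW : f' 0 * g 0 - f 0 * g' 0 ≠ 0) (hfd : Decaying Y f f') : ¬ Decaying Y g g' := by
  intro hgd
  obtain ⟨f1, f2⟩ := hfd.tendsto hB hqc hY hc hq hf
  obtain ⟨g1, g2⟩ := hgd.tendsto hB hqc hY hc hq hg
  have t3 : Tendsto (fun x => f' x * g x - f x * g' x) atTop (𝓝 0) := by
    simpa using (f2.mul g1).sub (f1.mul g2)
  have t4 : Tendsto (fun x => f' x * g x - f x * g' x) atTop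
      (𝓝 (f' 0 * g 0 - f 0 * g' 0)) := by
    refine tendsto_const_nhds.congr' ?_
    filter_upwards [eventually_ge_atTop 0] with x hx
    exact (hf.wronskian_eq hg hx).symm
  exact hW (tendsto_nhds_unique t4 t3)

end Uniqueness

noncomputable section

/-! ### The explicit soliton and its derivative -/

section Soliton

/-- `α + γ cosh (2 κ y)`. -/
def solDen (κ α γ y : ℝ) : ℝ := α + γ * Real.cosh (2 * κ * y)

/-- The potential of the linearization at the soliton on the whole line. -/
def solPot (κ α γ y : ℝ) : ℝ :=
  κ ^ 2 * (1 - 12 * α / solDen κ α γ y - 15 * (γ ^ 2 - α ^ 2) / solDen κ α γ y ^ 2)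

/-- A multiple of the derivative of the soliton. -/
def solDeriv (κ α γ y : ℝ) : ℝ :=
  -Real.sinh (2 * κ * y) / (solDen κ α γ y * √(solDen κ α γ y))

/-- The derivative of `solDeriv`. -/
def solDeriv' (κ α γ y : ℝ) : ℝ :=
  κ * (3 * γ * Real.sinh (2 * κ * y) ^ 2 - 2 * Real.cosh (2 * κ * y) * solDen κ α γ y) /
    (solDen κ α γ y ^ 2 * √(solDen κ α γ y))

variable {κ α γ : ℝ}

lemma solDen_pos (hα : 0 < α) (hγ : 0 < γ) (y : ℝ) : 0 < solDen κ α γ y := by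
  have := Real.cosh_pos (2 * κ * y)
  unfold solDen
  positivity

lemma lt_solDen (hγ : 0 < γ) (y : ℝ) : α < solDen κ α γ y := by
  have := Real.cosh_pos (2 * κ * y)
  unfold solDen
  have : 0 < γ * Real.cosh (2 * κ * y) := by positivity
  linarith

lemma mul_cosh_lt_solDen (hα : 0 < α) (y : ℝ) :
    γ * Real.cosh (2 * κ * y) < solDen κ α γ y := by
  unfold solDen
  linarith

lemma continuous_solDen : Continuous (solDen κ α γ) := by
  unfold solDen
  fun_prop

lemma hasDerivAt_solDen (y : ℝ) :
    HasDerivAt (solDen κ α γ) (2 * κ * γ * Real.sinh (2 * κ * y)) y := by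
  have := ((((hasDerivAt_id y).const_mul (2 * κ)).cosh).const_mul γ).const_add α
  refine this.congr_deriv ?_
  simp only [id]
  ring

lemma hasDerivAt_sinh_mul (y : ℝ) :
    HasDerivAt (fun y => Real.sinh (2 * κ * y)) (2 * κ * Real.cosh (2 * κ * y)) y := by
  refine (((hasDerivAt_id y).const_mul (2 * κ)).sinh).congr_deriv ?_
  simp only [id]
  ring

lemma hasDerivAt_cosh_mul (y : ℝ) :
    HasDerivAt (fun y => Real.cosh (2 * κ * y)) (2 * κ * Real.sinh (2 * κ * y)) y := by
  refine (((hasDerivAt_id y).const_mul (2 * κ)).cosh).congr_deriv ?_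
  simp only [id]
  ring

lemma hasDerivAt_solDeriv (hα : 0 < α) (hγ : 0 < γ) (y : ℝ) :
    HasDerivAt (solDeriv κ α γ) (solDeriv' κ α γ y) y := by
  have hD := solDen_pos (κ := κ) hα hγ y
  have hd := hasDerivAt_solDen (κ := κ) (α := α) (γ := γ) y
  have hs := Real.sqrt_pos.2 hD
  refine ((hasDerivAt_sinh_mul y).neg.div (hd.mul (hd.sqrt hD.ne'))
    (by simp only [Pi.mul_apply]; positivity)).congr_deriv ?_
  have hsq : √(solDen κ α γ y) ^ 2 = solDen κ α γ y := Real.sq_sqrt hD.le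
  simp only [Pi.mul_apply, Pi.neg_apply, solDeriv']
  set D := solDen κ α γ y
  set e := √D
  rw [← hsq]
  field_simp
  ring

/-- This is the derivative of the soliton equation, checked here as an identity in `e = √D`, `C =
cosh` and `S = sinh`, with `α = e² - γ C` and `S² = C² - 1` eliminated. -/
lemma hasDerivAt_solDeriv' (hα : 0 < α) (hγ : 0 < γ) (y : ℝ) :
    HasDerivAt (solDeriv' κ α γ) (solPot κ α γ y * solDeriv κ α γ y) y := by
  have hD := solDen_pos (κ := κ) hα hγ y
  have hd := hasDerivAt_solDen (κ := κ) (α := α) (γ := γ) y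
  have hs := Real.sqrt_pos.2 hD
  have h1 := ((((hasDerivAt_sinh_mul (κ := κ) y).pow 2).const_mul (3 * γ)).sub
    (((hasDerivAt_cosh_mul (κ := κ) y).const_mul 2).mul hd)).const_mul κ
  refine (h1.div ((hd.pow 2).mul (hd.sqrt hD.ne'))
    (by simp only [Pi.mul_apply, Pi.pow_apply]; positivity)).congr_deriv ?_
  have hsq : √(solDen κ α γ y) ^ 2 = solDen κ α γ y := Real.sq_sqrt hD.le
  have hα' : α = √(solDen κ α γ y) ^ 2 - γ * Real.cosh (2 * κ * y) := by
    rw [hsq, solDen]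
    ring
  have hS : Real.sinh (2 * κ * y) ^ 2 = Real.cosh (2 * κ * y) ^ 2 - 1 := by
    have := Real.cosh_sq (2 * κ * y)
    linarith
  simp only [Pi.mul_apply, Pi.pow_apply, Pi.sub_apply, solPot, solDeriv]
  generalize Real.sinh (2 * κ * y) = S at *
  generalize Real.cosh (2 * κ * y) = C at *
  generalize solDen κ α γ y = D at *
  generalize √D = e at *
  subst hsq
  field_simp
  subst hα'
  rw [show S ^ 2 = C ^ 2 - 1 from hS]
  ring

lemma tendsto_cosh_mul (hκ : 0 < κ) : Tendsto (fun y => Real.cosh (2 * κ * y)) atTop atTop := by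
  have h : Tendsto (fun y : ℝ => 2 * κ * y) atTop atTop :=
    tendsto_id.const_mul_atTop (by positivity)
  refine tendsto_atTop_mono' _ ?_ h
  filter_upwards [eventually_ge_atTop 0] with y hy
  exact (Real.self_le_sinh_iff.2 (by positivity)).trans (Real.sinh_lt_cosh _).le

/-- The bound has the form `C² / D³` with `D ≥ γ C`, which is how both `solDeriv` and its derivative
decay. -/
lemma tendsto_of_sq_le {k : ℝ → ℝ} {A : ℝ} (hκ : 0 < κ) (hγ : 0 < γ)
    (hk : ∀ y, k y ^ 2 ≤ A / (γ ^ 3 * Real.cosh (2 * κ * y))) : Tendsto k atTop (𝓝 0) := by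
  have h1 : Tendsto (fun y => √(A / (γ ^ 3 * Real.cosh (2 * κ * y)))) atTop (𝓝 0) := by
    have := (((tendsto_cosh_mul hκ).const_mul_atTop (pow_pos hγ 3)).const_div_atTop A).sqrt
    simpa using this
  exact squeeze_zero_norm (fun y => Real.le_sqrt_of_sq_le (by simpa using hk y)) h1

lemma tendsto_solDeriv (hκ : 0 < κ) (hα : 0 < α) (hγ : 0 < γ) :
    Tendsto (solDeriv κ α γ) atTop (𝓝 0) := by
  refine tendsto_of_sq_le (A := 1) hκ hγ fun y => ?_
  have hD := solDen_pos (κ := κ) hα hγ y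
  have hC := Real.cosh_pos (2 * κ * y)
  have hDC := mul_cosh_lt_solDen (κ := κ) (γ := γ) hα y
  have hS := Real.cosh_sq (2 * κ * y)
  have h3 : (γ * Real.cosh (2 * κ * y)) ^ 3 ≤ solDen κ α γ y ^ 3 := by gcongr
  rw [solDeriv, div_pow, mul_pow, Real.sq_sqrt hD.le, neg_sq, ← pow_succ,
    div_le_div_iff₀ (by positivity) (by positivity), one_mul]
  refine le_trans ?_ h3
  rw [mul_pow, pow_succ _ 2]
  have h4 : 0 < γ ^ 3 * Real.cosh (2 * κ * y) := by positivity
  nlinarith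

lemma tendsto_solDeriv' (hκ : 0 < κ) (hα : 0 < α) (hγ : 0 < γ) :
    Tendsto (solDeriv' κ α γ) atTop (𝓝 0) := by
  refine tendsto_of_sq_le (A := 25 * κ ^ 2) hκ hγ fun y => ?_
  have hD := solDen_pos (κ := κ) hα hγ y
  have hC := Real.cosh_pos (2 * κ * y)
  have hDC := mul_cosh_lt_solDen (κ := κ) (γ := γ) hα y
  have hS := Real.cosh_sq (2 * κ * y)
  rw [solDeriv', div_pow, mul_pow, mul_pow, Real.sq_sqrt hD.le]
  set C := Real.cosh (2 * κ * y)
  set S := Real.sinh (2 * κ * y)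
  set D := solDen κ α γ y
  have h3 : (γ * C) ^ 3 ≤ D ^ 3 := by gcongr
  have hn : |3 * γ * S ^ 2 - 2 * C * D| ≤ 5 * (C * D) := by
    have e1 : γ * S ^ 2 ≤ C * D := by
      have : S ^ 2 ≤ C ^ 2 := by linarith
      nlinarith
    have e2 : 0 ≤ γ * S ^ 2 := by positivity
    have e3 : 0 ≤ C * D := by positivity
    rw [abs_le]
    constructor <;> linarith
  have hn2 : (3 * γ * S ^ 2 - 2 * C * D) ^ 2 ≤ 25 * (C ^ 2 * D ^ 2) := by
    rw [← sq_abs]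
    calc _ ≤ (5 * (C * D)) ^ 2 := by gcongr
      _ = _ := by ring
  rw [div_le_div_iff₀ (by positivity) (by positivity)]
  calc κ ^ 2 * (3 * γ * S ^ 2 - 2 * C * D) ^ 2 * (γ ^ 3 * C)
      ≤ κ ^ 2 * (25 * (C ^ 2 * D ^ 2)) * (γ ^ 3 * C) := by gcongr
    _ = 25 * κ ^ 2 * D ^ 2 * (γ * C) ^ 3 := by ring
    _ ≤ 25 * κ ^ 2 * D ^ 2 * D ^ 3 := by gcongr
    _ = 25 * κ ^ 2 * ((D ^ 2) ^ 2 * D) := by ring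

lemma continuous_solPot (hα : 0 < α) (hγ : 0 < γ) : Continuous (solPot κ α γ) := by
  have hD := fun y => (solDen_pos (κ := κ) hα hγ y).ne'
  unfold solPot
  exact continuous_const.mul ((continuous_const.sub (continuous_const.div continuous_solDen hD)).sub
    (continuous_const.div (continuous_solDen.pow 2) fun y => pow_ne_zero 2 (hD y)))

lemma abs_solPot_le (hα : 0 < α) (hγ : 0 < γ) (y : ℝ) :
    |solPot κ α γ y| ≤ κ ^ 2 * (1 + 12 + 15 * |γ ^ 2 - α ^ 2| / α ^ 2) := by
  have hD := solDen_pos (κ := κ) hα hγ y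
  have hαD := (lt_solDen (κ := κ) (α := α) hγ y).le
  rw [solPot, abs_mul, abs_of_nonneg (sq_nonneg κ)]
  gcongr
  refine (abs_sub _ _).trans (add_le_add ((abs_sub _ _).trans (add_le_add (by simp) ?_)) ?_)
  · rw [abs_of_nonneg (by positivity), div_le_iff₀ hD]
    linarith
  · rw [abs_div, abs_mul, abs_of_nonneg (sq_nonneg (solDen κ α γ y)),
      abs_of_nonneg (by norm_num : (0 : ℝ) ≤ 15)]
    gcongr

lemma eventually_le_solPot (hκ : 0 < κ) (hα : 0 < α) (hγ : 0 < γ) :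
    ∀ᶠ y in atTop, κ ^ 2 / 2 ≤ solPot κ α γ y := by
  have hD : Tendsto (solDen κ α γ) atTop atTop :=
    tendsto_atTop_mono (fun y => (mul_cosh_lt_solDen hα y).le)
      ((tendsto_cosh_mul hκ).const_mul_atTop hγ)
  have h1 : Tendsto (solPot κ α γ) atTop (𝓝 (κ ^ 2 * (1 - 0 - 0))) :=
    ((tendsto_const_nhds.sub (hD.const_div_atTop _)).sub
      (((tendsto_pow_atTop two_ne_zero).comp hD).const_div_atTop _)).const_mul _
  have h2 : κ ^ 2 / 2 < κ ^ 2 * (1 - 0 - 0) := by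
    have : 0 < κ ^ 2 := by positivity
    linarith
  filter_upwards [h1.eventually (lt_mem_nhds h2)] with y hy using hy.le

lemma solDeriv_neg (hκ : 0 < κ) (hα : 0 < α) (hγ : 0 < γ) {y : ℝ} (hy : 0 < y) :
    solDeriv κ α γ y < 0 := by
  have hD := solDen_pos (κ := κ) hα hγ y
  have hs := Real.sqrt_pos.2 hD
  exact div_neg_of_neg_of_pos (neg_neg_of_pos (Real.sinh_pos_iff.2 (by positivity)))
    (by positivity)

lemma solDeriv_pos (hκ : 0 < κ) (hα : 0 < α) (hγ : 0 < γ) {y : ℝ} (hy : y < 0) :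
    0 < solDeriv κ α γ y := by
  have hD := solDen_pos (κ := κ) hα hγ y
  have hs := Real.sqrt_pos.2 hD
  refine div_pos (neg_pos.2 (Real.sinh_neg_iff.2 ?_)) (by positivity)
  nlinarith

/-- Strict logarithmic concavity of the soliton. -/
lemma solDeriv_logConcave (hκ : 0 < κ) (hα : 0 < α) (hγ : 0 < γ) (y : ℝ) :
    0 < -(κ * γ * Real.sinh (2 * κ * y) / solDen κ α γ y) * solDeriv κ α γ y -
      solDeriv' κ α γ y := by
  have hD := solDen_pos (κ := κ) hα hγ y
  have hs := Real.sqrt_pos.2 hD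
  have hS := Real.cosh_sq (2 * κ * y)
  have hC := Real.cosh_pos (2 * κ * y)
  have e : -(κ * γ * Real.sinh (2 * κ * y) / solDen κ α γ y) * solDeriv κ α γ y -
      solDeriv' κ α γ y = 2 * κ * (Real.cosh (2 * κ * y) * solDen κ α γ y -
        γ * Real.sinh (2 * κ * y) ^ 2) / (solDen κ α γ y ^ 2 * √(solDen κ α γ y)) := by
    rw [solDeriv, solDeriv']
    field_simp
    ring
  rw [e]
  refine div_pos (mul_pos (by positivity) ?_) (by positivity)
  -- The positivity is that of `α cosh + γ`, what remains after `cosh² - sinh² = 1`.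
  have : Real.cosh (2 * κ * y) * solDen κ α γ y - γ * Real.sinh (2 * κ * y) ^ 2 =
      α * Real.cosh (2 * κ * y) + γ := by
    rw [solDen]
    linear_combination γ * hS
  rw [this]
  positivity

end Soliton

/-! ### From the peak profile to half-line data -/

section Profile

variable {lam₁ lam₂ ω Z : ℝ}

lemma Admissible.gamma_sq_pos (h : Admissible lam₁ lam₂ ω Z) :
    0 < (lam₁ / 4) ^ 2 - lam₂ / 3 * ω := by
  obtain ⟨hω, ⟨h1, h2, _⟩ | ⟨h1, h2, _, h3⟩⟩ := h
  · have := mul_pos h2 (neg_pos.2 hω)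
    nlinarith [sq_pos_of_pos h1]
  · rw [lt_div_iff_of_neg (by linarith)] at h3
    nlinarith

lemma Admissible.sq_lt (h : Admissible lam₁ lam₂ ω Z) : Z ^ 2 / 4 < -ω := by
  rcases h.2 with h | h
  · exact h.2.2
  · exact h.2.2.1

lemma Admissible.lam_pos (h : Admissible lam₁ lam₂ ω Z) : 0 < lam₁ := by
  rcases h.2 with h | h <;> exact h.1

lemma tendsto_R_atTop {lam₁ lam₂ ω : ℝ} (hκ : 0 < √(-ω))
    (hγ : 0 < √((lam₁ / 4) ^ 2 - lam₂ / 3 * ω)) :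
    Tendsto (R lam₁ lam₂ ω) atTop (𝓝 1) := by
  set κ := √(-ω)
  set γ := √((lam₁ / 4) ^ 2 - lam₂ / 3 * ω) with hγd
  have hC := tendsto_cosh_mul hκ
  have h1 : Tendsto (fun y => Real.sinh (2 * κ * y) / Real.cosh (2 * κ * y)) atTop (𝓝 1) := by
    have hlim : Tendsto (fun y => 1 - 1 / Real.cosh (2 * κ * y)) atTop (𝓝 (1 - 0)) :=
      tendsto_const_nhds.sub (hC.const_div_atTop 1)
    rw [sub_zero] at hlim
    refine tendsto_of_tendsto_of_tendsto_of_le_of_le' hlim tendsto_const_nhds ?_ ?_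
    · filter_upwards [eventually_ge_atTop 0] with y hy
      have hc := Real.cosh_pos (2 * κ * y)
      have hexp : Real.exp (-(2 * κ * y)) ≤ 1 := Real.exp_le_one_iff.2 (by
        have : 0 ≤ 2 * κ * y := by positivity
        linarith)
      rw [← Real.cosh_sub_sinh] at hexp
      rw [one_sub_div hc.ne']
      gcongr
      linarith
    · refine Eventually.of_forall fun y => ?_
      exact (div_le_one (Real.cosh_pos _)).2 (Real.sinh_lt_cosh _).le
  have h2 : Tendsto (fun y => lam₁ / 4 / Real.cosh (2 * κ * y) + γ) atTop (𝓝 (0 + γ)) :=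
    (hC.const_div_atTop _).add tendsto_const_nhds
  have h3 := (h1.const_mul γ).div h2 (by rw [zero_add]; exact hγ.ne')
  rw [zero_add, mul_one, div_self hγ.ne'] at h3
  refine h3.congr fun y => ?_
  have hc := (Real.cosh_pos (2 * κ * y)).ne'
  simp only [R, Pi.div_apply]
  rw [← hγd, mul_div_assoc', div_add' _ _ _ hc, div_div_div_cancel_right₀ hc]

lemma R_neg (lam₁ lam₂ ω s : ℝ) : R lam₁ lam₂ ω (-s) = -R lam₁ lam₂ ω s := by
  simp [R, neg_div]

/-- Only surjectivity of `R` onto `(-1, 1)` is needed: it is continuous, odd and tends to `1`, and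
`Z²/4 < -ω` places the target in that interval. Any preimage would do. -/
lemma Admissible.R_shift (h : Admissible lam₁ lam₂ ω Z) :
    R lam₁ lam₂ ω (shift lam₁ lam₂ ω Z) = Z / (2 * √(-ω)) := by
  have hω : 0 < -ω := neg_pos.2 h.1
  have hκ : 0 < √(-ω) := Real.sqrt_pos.2 hω
  have hγ := Real.sqrt_pos.2 h.gamma_sq_pos
  have hα : 0 < lam₁ / 4 := by linarith [h.lam_pos]
  have hcont : Continuous (R lam₁ lam₂ ω) := by
    unfold R
    refine Continuous.div (by fun_prop) (by fun_prop) fun s => ?_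
    exact (solDen_pos (κ := √(-ω)) hα hγ s).ne'
  have hZ : |Z / (2 * √(-ω))| < 1 := by
    rw [abs_div, abs_of_pos (by positivity : 0 < 2 * √(-ω)), div_lt_one (by positivity)]
    refine abs_lt_of_sq_lt_sq ?_ (by positivity)
    rw [mul_pow, Real.sq_sqrt hω.le]
    linarith [h.sq_lt]
  rw [abs_lt] at hZ
  have ht := tendsto_R_atTop (lam₁ := lam₁) (lam₂ := lam₂) hκ hγ
  obtain ⟨b, hb⟩ := (ht.eventually (lt_mem_nhds hZ.2)).exists
  obtain ⟨a, ha⟩ := (ht.eventually (lt_mem_nhds (neg_lt.1 hZ.1))).exists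
  rw [neg_lt, ← R_neg] at ha
  exact Function.invFun_eq (mem_range_of_exists_le_of_exists_ge hcont ⟨_, ha.le⟩ ⟨_, hb.le⟩)

/-- The half-line problem underlying the linearized operator: a bounded potential `q`, bounded
below by `c > 0` from `Y` on, and a decaying zero-energy solution `ψ`. -/
structure HalfLineData (q : ℝ → ℝ) (B Y c Z : ℝ) (ψ ψ' : ℝ → ℝ) : Prop where
  continuous : Continuous q
  bound : ∀ x, |q x| ≤ B
  Y_nonneg : 0 ≤ Y
  c_pos : 0 < c
  le : ∀ y, Y ≤ y → c ≤ q y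
  sol : IsSol q 0 ψ ψ'
  tendsto : Tendsto ψ atTop (𝓝 0)
  tendsto' : Tendsto ψ' atTop (𝓝 0)
  neg : ∀ᶠ y in atTop, ψ y < 0
  logConcave : 0 < -(Z / 2) * ψ 0 - ψ' 0
  of_pos : 0 < Z → ∀ x, 0 ≤ x → ψ x ≠ 0
  of_neg : Z < 0 → 0 < ψ 0 ∧ ∃ x₀, 0 ≤ x₀ ∧ ∀ x, 0 ≤ x → x ≠ x₀ → ψ x ≠ 0

/-- This rests on `φ² = -ω / D` and `γ² - α² = -β ω`. -/
lemma Admissible.potential_eq (h : Admissible lam₁ lam₂ ω Z) (x : ℝ) :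
    potential lam₁ lam₂ ω Z x =
      solPot √(-ω) (lam₁ / 4) √((lam₁ / 4) ^ 2 - lam₂ / 3 * ω) (|x| + shift lam₁ lam₂ ω Z) := by
  have hω : 0 < -ω := neg_pos.2 h.1
  have hκ : 0 < √(-ω) := Real.sqrt_pos.2 hω
  have hγ := Real.sqrt_pos.2 h.gamma_sq_pos
  have hα : 0 < lam₁ / 4 := by linarith [h.lam_pos]
  have hγ2 := Real.sq_sqrt h.gamma_sq_pos.le
  have hκ2 := Real.sq_sqrt hω.le
  set κ := √(-ω)
  set γ := √((lam₁ / 4) ^ 2 - lam₂ / 3 * ω) with hγd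
  set y := |x| + shift lam₁ lam₂ ω Z with hy
  have hD := solDen_pos (κ := κ) hα hγ y
  have hp : profile lam₁ lam₂ ω Z x ^ 2 = -ω / solDen κ (lam₁ / 4) γ y := by
    have e : lam₁ / 4 / -ω + γ / -ω * Real.cosh (2 * κ * y) =
        solDen κ (lam₁ / 4) γ y / -ω := by
      rw [solDen]
      ring
    rw [profile, ← hγd, ← hy, e, ← Real.rpow_natCast, ← Real.rpow_mul (by positivity)]
    norm_num
    rw [Real.rpow_neg_one, inv_div, neg_div]
  have hp4 : profile lam₁ lam₂ ω Z x ^ 4 = (-ω / solDen κ (lam₁ / 4) γ y) ^ 2 := by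
    rw [← hp]
    ring
  have hl : γ ^ 2 - (lam₁ / 4) ^ 2 = lam₂ / 3 * (-ω) := by
    rw [hγ2]
    ring
  rw [potential, hp, hp4, solPot, hl, hκ2]
  field_simp
  ring

/-- The linearized operator reduces to a half-line problem with all the required properties. -/
theorem Admissible.exists_halfLineData (h : Admissible lam₁ lam₂ ω Z) :
    ∃ q B Y c ψ ψ', HalfLineData q B Y c Z ψ ψ' ∧ ∀ x, potential lam₁ lam₂ ω Z x = q |x| := by
  have hω : 0 < -ω := neg_pos.2 h.1
  have hκ : 0 < √(-ω) := Real.sqrt_pos.2 hω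
  have hγ := Real.sqrt_pos.2 h.gamma_sq_pos
  have hα : 0 < lam₁ / 4 := by linarith [h.lam_pos]
  have hR := h.R_shift
  have hpot := h.potential_eq
  set κ := √(-ω)
  set γ := √((lam₁ / 4) ^ 2 - lam₂ / 3 * ω) with hγd
  set s := shift lam₁ lam₂ ω Z
  set α := lam₁ / 4
  have hD := solDen_pos (κ := κ) hα hγ s
  -- The right-hand side is minus the logarithmic derivative of the soliton at `s`. It also shows
  -- that `s` has the sign of `Z`.
  have hZ : Z / 2 = κ * γ * Real.sinh (2 * κ * s) / solDen κ α γ s := by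
    change γ * Real.sinh (2 * κ * s) / solDen κ α γ s = Z / (2 * κ) at hR
    rw [mul_assoc, mul_div_assoc, hR]
    field_simp
  have hshift : Tendsto (fun x : ℝ => x + s) atTop atTop :=
    tendsto_atTop_add_const_right _ _ tendsto_id
  obtain ⟨Y, hY⟩ := eventually_atTop.1 (hshift.eventually (eventually_le_solPot hκ hα hγ))
  refine ⟨fun x => solPot κ α γ (x + s), _, max Y 0, κ ^ 2 / 2, fun x => solDeriv κ α γ (x + s),
    fun x => solDeriv' κ α γ (x + s), ⟨(continuous_solPot hα hγ).comp (by fun_prop),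
    fun x => abs_solPot_le hα hγ _, le_max_right _ _, by positivity,
    fun y hy => hY y ((le_max_left _ _).trans hy),
    ⟨fun x _ => (hasDerivAt_solDeriv hα hγ (x + s)).comp_add_const x s, fun x _ => by
      rw [sub_zero]; exact (hasDerivAt_solDeriv' hα hγ (x + s)).comp_add_const x s⟩,
    (tendsto_solDeriv hκ hα hγ).comp hshift, (tendsto_solDeriv' hκ hα hγ).comp hshift,
    ?_, ?_, ?_, ?_⟩, hpot⟩
  · filter_upwards [hshift.eventually (eventually_gt_atTop 0)] with y hy
    exact solDeriv_neg hκ hα hγ hy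
  · rw [hZ, zero_add]
    exact solDeriv_logConcave hκ hα hγ s
  · intro hZ0 x hx
    have hs : 0 < s := by
      by_contra! hle
      have h1 : Real.sinh (2 * κ * s) ≤ 0 := Real.sinh_nonpos_iff.2 (by nlinarith)
      have h2 : κ * γ * Real.sinh (2 * κ * s) / solDen κ α γ s ≤ 0 :=
        div_nonpos_of_nonpos_of_nonneg (mul_nonpos_of_nonneg_of_nonpos (by positivity) h1) hD.le
      linarith
    exact (solDeriv_neg hκ hα hγ (by linarith)).ne
  · intro hZ0
    have hs : s < 0 := by
      by_contra! hle
      have h1 : 0 ≤ Real.sinh (2 * κ * s) := Real.sinh_nonneg_iff.2 (by positivity)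
      have h2 : 0 ≤ κ * γ * Real.sinh (2 * κ * s) / solDen κ α γ s := by positivity
      linarith
    refine ⟨by rw [zero_add]; exact solDeriv_pos hκ hα hγ hs, -s, by linarith, fun x _ hne => ?_⟩
    rcases lt_or_gt_of_ne hne with hlt | hgt
    · exact (solDeriv_pos hκ hα hγ (by linarith)).ne'
    · exact (solDeriv_neg hκ hα hγ (by linarith)).ne

end Profile

end

/-! ### Weak solutions are classical -/

section WeakReal

/-- `v` is the weak derivative of the real function `u` on the open set `U`. -/
def IsWeakDerivReal (U : Set ℝ) (u v : ℝ → ℝ) : Prop :=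
  ∀ ψ : ℝ → ℝ, ContDiff ℝ (⊤ : ℕ∞) ψ → HasCompactSupport ψ → tsupport ψ ⊆ U →
    ∫ x, deriv ψ x * u x = -∫ x, ψ x * v x

variable {U : Set ℝ} {u v w : ℝ → ℝ}

lemma locallyIntegrable_test_mul {ψ : ℝ → ℝ} (hψ : Continuous ψ) (hs : HasCompactSupport ψ)
    (hu : LocallyIntegrable u) : Integrable fun x => ψ x * u x :=
  hu.integrable_smul_left_of_hasCompactSupport hψ hs

lemma exists_support_subset_Icc {ψ : ℝ → ℝ} (hs : HasCompactSupport ψ) :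
    ∃ r, 0 < r ∧ ∀ x, r ≤ |x| → ψ x = 0 := by
  obtain ⟨r, hr⟩ := hs.isCompact.isBounded.subset_ball 0
  refine ⟨max r 1, by positivity, fun x hx => ?_⟩
  by_contra hne
  have := hr (subset_tsupport _ hne)
  rw [Metric.mem_ball, dist_zero_right, Real.norm_eq_abs] at this
  exact absurd this (not_lt.2 ((le_max_left _ _).trans hx))

lemma integral_eq_of_support {k : ℝ → ℝ} {r : ℝ} (hk : ∀ x, r ≤ |x| → k x = 0) :
    ∫ x, k x = ∫ x in (-r)..r, k x := by
  refine (intervalIntegral.integral_eq_integral_of_support_subset fun x hx => ?_).symm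
  by_contra hx'
  refine hx (hk x ?_)
  by_contra! hlt
  rw [abs_lt] at hlt
  exact hx' ⟨hlt.1, hlt.2.le⟩

lemma deriv_eq_zero_of_support {ψ : ℝ → ℝ} {r : ℝ} (hr : ∀ x, r ≤ |x| → ψ x = 0) {x : ℝ}
    (hx : r < |x|) : deriv ψ x = 0 := by
  have : ψ =ᶠ[𝓝 x] fun _ => 0 := by
    filter_upwards [(continuous_abs.tendsto x).eventually (lt_mem_nhds hx)] with y hy
    exact hr y (le_of_lt hy)
  rw [this.deriv_eq, deriv_const]

/-- The primitive of a locally integrable function has that function as weak derivative. -/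
lemma isWeakDerivReal_primitive (hv : LocallyIntegrable v) :
    IsWeakDerivReal U (fun x => ∫ t in (0 : ℝ)..x, v t) v := by
  intro ψ hψ hs _
  obtain ⟨r, hr0, hr⟩ := exists_support_subset_Icc hs
  have hr' : ∀ x, r + 1 ≤ |x| → ψ x = 0 := fun x hx => hr x (by linarith)
  have hrd : ∀ x, r + 1 ≤ |x| → deriv ψ x = 0 := fun x hx =>
    deriv_eq_zero_of_support hr (by linarith)
  have hi (a b : ℝ) : IntervalIntegrable v volume a b :=
    (hv.integrableOn_isCompact isCompact_uIcc).intervalIntegrable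
  have hac : AbsolutelyContinuousOnInterval (fun x => ∫ t in (0 : ℝ)..x, v t) (-(r + 1)) (r + 1) :=
    (hi _ _).absolutelyContinuousOnInterval_intervalIntegral
      (by rw [Set.uIcc_of_le (by linarith)]; constructor <;> linarith)
  have hac' : AbsolutelyContinuousOnInterval ψ (-(r + 1)) (r + 1) :=
    ((hψ.of_le (by simp)).contDiffOn).absolutelyContinuousOnInterval
  have h := hac'.integral_mul_deriv_eq_deriv_mul hac
  rw [hr' (r + 1) (le_abs_self _), hr' (-(r + 1)) (by rw [abs_neg]; exact le_abs_self _)] at h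
  have hd : ∫ x in (-(r + 1))..(r + 1), ψ x * deriv (fun x => ∫ t in (0 : ℝ)..x, v t) x =
      ∫ x in (-(r + 1))..(r + 1), ψ x * v x := by
    refine intervalIntegral.integral_congr_ae ?_
    filter_upwards [_root_.LocallyIntegrable.ae_hasDerivAt_integral hv] with x hx _
    rw [(hx 0).deriv]
  rw [hd] at h
  rw [integral_eq_of_support (r := r + 1) (fun x hx => by rw [hrd x hx, zero_mul]),
    integral_eq_of_support (r := r + 1) (fun x hx => by rw [hr' x hx, zero_mul]), h]
  ring

/-- The lemma of du Bois-Reymond: a function with vanishing weak derivative on an interval is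
constant there. -/
lemma ae_eq_const_of_isWeakDerivReal (hU : IsOpen U) (hU' : U.OrdConnected)
    (hu : LocallyIntegrable u) (h : IsWeakDerivReal U u fun _ => 0) :
    ∃ c, ∀ᵐ x, x ∈ U → u x = c := by
  rcases U.eq_empty_or_nonempty with rfl | ⟨x₀, hx₀⟩
  · exact ⟨0, by simp⟩
  obtain ⟨ε, hε, hεU⟩ := Metric.isOpen_iff.1 hU x₀ hx₀
  let b : ContDiffBump x₀ := ⟨ε / 4, ε / 2, by positivity, by linarith⟩
  set η : ℝ → ℝ := b.normed volume with hη
  have hη1 : ContDiff ℝ (⊤ : ℕ∞) η := b.contDiff_normed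
  have hη2 : HasCompactSupport η := b.hasCompactSupport_normed
  have hη3 : ∫ x, η x = 1 := b.integral_normed
  have hη4 : tsupport η ⊆ U := by
    rw [hη, b.tsupport_normed_eq]
    exact (Metric.closedBall_subset_ball (by change ε / 2 < ε; linarith)).trans hεU
  refine ⟨∫ x, η x * u x, ?_⟩
  have hloc : LocallyIntegrable fun x => u x - ∫ x, η x * u x :=
    hu.sub (locallyIntegrable_const _)
  have := hU.ae_eq_zero_of_integral_contDiff_smul_eq_zero
    (f := fun x => u x - ∫ x, η x * u x) (hloc.locallyIntegrableOn U) fun ψ hψ hs hψU => ?_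
  · filter_upwards [this] with x hx hxU using sub_eq_zero.1 (hx hxU)
  set m := ∫ x, ψ x with hm
  -- Removing `m η` makes the integral zero, so the primitive `θ` of `k` has compact support and is
  -- itself a test function. Order-connectedness keeps the convex hull of the supports inside `U`.
  set k : ℝ → ℝ := fun x => ψ x - m * η x with hk
  have hkc : ContDiff ℝ (⊤ : ℕ∞) k := hψ.sub (contDiff_const.mul hη1)
  have hψi : Integrable ψ := hψ.continuous.integrable_of_hasCompactSupport hs
  have hηi : Integrable η := hη1.continuous.integrable_of_hasCompactSupport hη2
  have hki : Integrable k := hψi.sub (hηi.const_mul m)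
  have hk0 : ∫ x, k x = 0 := by
    rw [integral_sub hψi (hηi.const_mul m), integral_const_mul, hη3, ← hm]
    ring
  set S := tsupport ψ ∪ tsupport η with hS
  have hSc : IsCompact S := hs.isCompact.union hη2.isCompact
  have hSn : S.Nonempty := by
    refine ⟨x₀, Or.inr ?_⟩
    rw [hη, b.tsupport_normed_eq]
    exact Metric.mem_closedBall_self (by change 0 ≤ ε / 2; linarith)
  have hSU : S ⊆ U := Set.union_subset hψU hη4
  have hIcc : Set.Icc (sInf S) (sSup S) ⊆ U :=
    hU'.out (hSU (hSc.sInf_mem hSn)) (hSU (hSc.sSup_mem hSn))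
  have hkS (x : ℝ) (hx : x ∉ S) : k x = 0 := by
    simp only [hS, Set.mem_union, not_or] at hx
    simp [hk, image_eq_zero_of_notMem_tsupport hx.1, image_eq_zero_of_notMem_tsupport hx.2]
  have hlow (x : ℝ) (hx : x < sInf S) : k x = 0 := hkS x fun hxS =>
    absurd (csInf_le hSc.bddBelow hxS) (not_le.2 hx)
  have hhigh (x : ℝ) (hx : sSup S < x) : k x = 0 := hkS x fun hxS =>
    absurd (le_csSup hSc.bddAbove hxS) (not_le.2 hx)
  set θ : ℝ → ℝ := fun x => ∫ t in (sInf S)..x, k t with hθ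
  have hθd (x : ℝ) : HasDerivAt θ (k x) x :=
    (hkc.continuous.integral_hasStrictDerivAt _ x).hasDerivAt
  have hθ' : deriv θ = k := funext fun x => (hθd x).deriv
  have hθc : ContDiff ℝ (⊤ : ℕ∞) θ :=
    contDiff_infty_iff_deriv.2 ⟨fun x => (hθd x).differentiableAt, hθ' ▸ hkc⟩
  have hθs : Function.support θ ⊆ Set.Icc (sInf S) (sSup S) := by
    intro x hx
    by_contra hx'
    refine hx ?_
    rw [Set.mem_Icc, not_and_or, not_le, not_le] at hx'
    rcases hx' with hx' | hx'
    · change ∫ t in (sInf S)..x, k t = 0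
      refine intervalIntegral.integral_zero_ae ?_
      have : ∀ᵐ t : ℝ, t ≠ sInf S := by simp [ae_iff]
      filter_upwards [this] with t ht hts
      rw [Set.uIoc_of_ge hx'.le] at hts
      exact hlow t (lt_of_le_of_ne hts.2 ht)
    · change ∫ t in (sInf S)..x, k t = 0
      have hsub : Function.support k ⊆ Set.Icc (sInf S) x := by
        intro t ht
        constructor
        · by_contra! hlt
          exact ht (hlow t hlt)
        · by_contra! hlt
          exact ht (hhigh t (hx'.trans hlt))
      have hle : sInf S ≤ x :=
        (csInf_le_csSup hSn hSc.bddBelow hSc.bddAbove).trans hx'.le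
      rw [intervalIntegral.integral_of_le hle, ← integral_Icc_eq_integral_Ioc,
        setIntegral_eq_integral_of_forall_compl_eq_zero, hk0]
      intro t ht
      by_contra hne
      exact ht (hsub hne)
  have hθt : tsupport θ ⊆ Set.Icc (sInf S) (sSup S) := closure_minimal hθs isClosed_Icc
  have hfin := h θ hθc (HasCompactSupport.of_support_subset_isCompact isCompact_Icc hθs)
    (hθt.trans hIcc)
  rw [hθ'] at hfin
  simp only [mul_zero, integral_zero, neg_zero, hk, sub_mul] at hfin
  have e1 := locallyIntegrable_test_mul hψ.continuous hs hu
  have e2 := locallyIntegrable_test_mul hη1.continuous hη2 hu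
  simp only [smul_eq_mul, mul_sub]
  simp only [mul_assoc] at hfin
  rw [integral_sub e1 (e2.const_mul m), integral_const_mul] at hfin
  rw [integral_sub e1 (hψi.mul_const _), integral_mul_const]
  exact hfin

/-- Subtracting the primitive of `v` leaves a function with weak derivative `0`. -/
lemma IsWeakDerivReal.exists_primitive (hU : IsOpen U) (hU' : U.OrdConnected)
    (hu : LocallyIntegrable u) (hv : LocallyIntegrable v) (h : IsWeakDerivReal U u v) :
    ∃ c, ∀ᵐ x, x ∈ U → u x = c + ∫ t in (0 : ℝ)..x, v t := by
  have hi (a b : ℝ) : IntervalIntegrable v volume a b :=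
    (hv.integrableOn_isCompact isCompact_uIcc).intervalIntegrable
  have hp : LocallyIntegrable fun x => ∫ t in (0 : ℝ)..x, v t :=
    (intervalIntegral.continuous_primitive hi 0).locallyIntegrable
  obtain ⟨c, hc⟩ := ae_eq_const_of_isWeakDerivReal hU hU' (hu.sub hp) fun ψ hψ hs hψU => by
    have e1 := locallyIntegrable_test_mul (hψ.continuous_deriv (by simp)) hs.deriv hu
    have e2 := locallyIntegrable_test_mul (hψ.continuous_deriv (by simp)) hs.deriv hp
    simp only [Pi.sub_apply, mul_sub, mul_zero, integral_zero]
    rw [integral_sub e1 e2, h ψ hψ hs hψU, isWeakDerivReal_primitive hv ψ hψ hs hψU]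
    ring
  refine ⟨c, ?_⟩
  filter_upwards [hc] with x hx hxU
  have := hx hxU
  simp only [Pi.sub_apply] at this
  linarith

lemma IsWeakDerivReal.mono {U' : Set ℝ} (hUU : U' ⊆ U) (h : IsWeakDerivReal U u v) :
    IsWeakDerivReal U' u v := fun ψ hψ hs hU => h ψ hψ hs (hU.trans hUU)

lemma IsWeakDerivReal.comp_neg (h : IsWeakDerivReal U u v) :
    IsWeakDerivReal (-U) (fun x => u (-x)) (fun x => -v (-x)) := by
  intro ψ hψ hs hU
  have h1 := h (fun x => ψ (-x)) (hψ.comp contDiff_neg)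
    (hs.comp_homeomorph (Homeomorph.neg ℝ)) (by
      intro x hx
      have : -x ∈ tsupport ψ := by
        have hx' := tsupport_comp_subset_preimage ψ (continuous_neg (G := ℝ)) hx
        exact hx'
      simpa using hU this)
  have e : deriv (fun x => ψ (-x)) = fun x => -deriv ψ (-x) := by
    ext x
    rw [deriv_comp_neg]
  rw [e] at h1
  have e1 : ∫ x, deriv ψ x * u (-x) = ∫ x, deriv ψ (-x) * u x := by
    rw [← integral_neg_eq_self]
    simp
  have e2 : ∫ x, ψ x * -v (-x) = -∫ x, ψ (-x) * v x := by
    rw [← integral_neg_eq_self, ← integral_neg]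
    simp
  rw [e1, e2]
  simp only [neg_mul] at h1
  rw [integral_neg] at h1
  linarith

/-- A weak solution on the half-line is classical, up to the boundary. -/
lemma exists_isSol_of_weak {q : ℝ → ℝ} (hq : Continuous q) {μ : ℝ}
    (hu : LocallyIntegrable u) (hv : LocallyIntegrable v) (hw : LocallyIntegrable w)
    (huv : IsWeakDerivReal (Set.Ioi 0) u v) (hvw : IsWeakDerivReal (Set.Ioi 0) v w)
    (he : ∀ᵐ x, 0 < x → w x = (q x - μ) * u x) :
    ∃ f f', IsSol q μ f f' ∧ (∀ᵐ x, 0 < x → u x = f x) ∧ ∀ᵐ x, 0 < x → v x = f' x := by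
  obtain ⟨c₀, h0⟩ := huv.exists_primitive isOpen_Ioi Set.ordConnected_Ioi hu hv
  obtain ⟨c₁, h1⟩ := hvw.exists_primitive isOpen_Ioi Set.ordConnected_Ioi hv hw
  have hi (a b : ℝ) : IntervalIntegrable v volume a b :=
    (hv.integrableOn_isCompact isCompact_uIcc).intervalIntegrable
  set f₀ : ℝ → ℝ := fun x => c₀ + ∫ t in (0 : ℝ)..x, v t with hf₀
  have hf₀c : Continuous f₀ := continuous_const.add (intervalIntegral.continuous_primitive hi 0)
  set g : ℝ → ℝ := fun x => (q x - μ) * f₀ x with hg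
  have hgc : Continuous g := by fun_prop
  set f₁ : ℝ → ℝ := fun x => c₁ + ∫ t in (0 : ℝ)..x, g t with hf₁
  have hf₁d (x : ℝ) : HasDerivAt f₁ (g x) x :=
    (hgc.integral_hasStrictDerivAt _ x).hasDerivAt.const_add c₁
  have hf₁c : Continuous f₁ := continuous_iff_continuousAt.2 fun x => (hf₁d x).continuousAt
  have hae {k l : ℝ → ℝ} (hkl : ∀ᵐ x, 0 < x → k x = l x) {x : ℝ} (hx : 0 ≤ x) :
      ∫ t in (0 : ℝ)..x, k t = ∫ t in (0 : ℝ)..x, l t := by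
    refine intervalIntegral.integral_congr_ae ?_
    filter_upwards [hkl] with t ht hts
    rw [Set.uIoc_of_le hx] at hts
    exact ht hts.1
  have hwg : ∀ᵐ x, 0 < x → w x = g x := by
    filter_upwards [he, h0] with x hx hx0 hpos
    rw [hx hpos, hx0 hpos]
  have hvf : ∀ᵐ x, 0 < x → v x = f₁ x := by
    filter_upwards [h1] with x hx hpos
    rw [hx hpos, hae hwg hpos.le]
  have hff₀ (x : ℝ) (hx : 0 ≤ x) : c₀ + ∫ t in (0 : ℝ)..x, f₁ t = f₀ x := by
    rw [← hae hvf hx]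
  -- Integrating the continuous `f₁` instead of `v` gives a two-sided derivative at `0`; `v` agrees
  -- with `f₁` only almost everywhere on the positive side.
  refine ⟨fun x => c₀ + ∫ t in (0 : ℝ)..x, f₁ t, f₁, ⟨fun x _ =>
    (hf₁c.integral_hasStrictDerivAt _ x).hasDerivAt.const_add c₀, fun x hx => ?_⟩, ?_, hvf⟩
  · rw [hff₀ x hx]
    exact hf₁d x
  · filter_upwards [h0] with x hx hpos
    rw [hff₀ x hpos.le]
    exact hx hpos

/-- Integration by parts against a test function for a function differentiable off the origin. -/
lemma integral_deriv_mul_eq {G G' ψ : ℝ → ℝ} (hG : ∀ x, x ≠ 0 → HasDerivAt G (G' x) x)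
    (hGi : LocallyIntegrable G) (hG'i : LocallyIntegrable G') (hψ : ContDiff ℝ (⊤ : ℕ∞) ψ)
    (hs : HasCompactSupport ψ) (hc : Continuous fun x => ψ x * G x) :
    ∫ x, deriv ψ x * G x = -∫ x, ψ x * G' x := by
  obtain ⟨r, hr0, hr⟩ := exists_support_subset_Icc hs
  have hr' : ∀ x, r + 1 ≤ |x| → ψ x = 0 := fun x hx => hr x (by linarith)
  have hrd : ∀ x, r + 1 ≤ |x| → deriv ψ x = 0 := fun x hx =>
    deriv_eq_zero_of_support hr (by linarith)
  have e1 := locallyIntegrable_test_mul (hψ.continuous_deriv (by simp)) hs.deriv hGi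
  have e2 := locallyIntegrable_test_mul hψ.continuous hs hG'i
  have h := integral_eq_of_hasDerivAt_off_countable_of_le (fun x => ψ x * G x)
    (fun x => deriv ψ x * G x + ψ x * G' x) (a := -(r + 1)) (b := r + 1) (by linarith)
    (Set.countable_singleton 0) hc.continuousOn
    (fun x hx => ((hψ.differentiable (by simp) x).hasDerivAt).mul (hG x hx.2))
    (e1.add e2).intervalIntegrable
  rw [hr' (r + 1) (le_abs_self _), hr' (-(r + 1)) (by rw [abs_neg]; exact le_abs_self _),
    ← integral_eq_of_support (fun x hx => by rw [hr' x hx, hrd x hx]; simp),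
    integral_add e1 e2] at h
  linarith

end WeakReal

/-! ### Even and odd extensions -/

section Extension

/-- Even (`σ = 1`) or odd (`σ = -1`) extension of a function on the half-line. -/
noncomputable def extend (σ : ℝ) (f : ℝ → ℝ) (x : ℝ) : ℝ := (if 0 ≤ x then 1 else σ) * f |x|

variable {σ : ℝ} {f f' : ℝ → ℝ}

lemma extend_of_nonneg {x : ℝ} (hx : 0 ≤ x) : extend σ f x = f x := by
  simp [extend, hx, abs_of_nonneg hx]

lemma extend_of_neg {x : ℝ} (hx : x < 0) : extend σ f x = σ * f (-x) := by
  simp [extend, not_le.2 hx, abs_of_neg hx]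

lemma measurable_extend (hf : ContinuousOn f (Set.Ici 0)) : Measurable (extend σ f) := by
  refine Measurable.mul (Measurable.ite measurableSet_Ici measurable_const measurable_const) ?_
  exact (hf.comp_continuous continuous_abs fun x => abs_nonneg x).measurable

lemma integrable_comp_abs {k : ℝ → ℝ} (hk : IntegrableOn k (Set.Ioi 0)) :
    Integrable fun x => k |x| := by
  have h1 : IntegrableOn (fun x => k |x|) (Set.Ioi 0) :=
    hk.congr_fun (fun x hx => by rw [abs_of_pos hx]) measurableSet_Ioi
  have h2 : IntegrableOn (fun x => k |x|) (Set.Iic 0) := by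
    rw [← Measure.map_neg_eq_self (volume : Measure ℝ)]
    have m : MeasurableEmbedding fun x : ℝ => -x := (Homeomorph.neg ℝ).measurableEmbedding
    rw [m.integrableOn_map_iff]
    simp_rw [Function.comp_def, abs_neg, Set.neg_preimage, Set.neg_Iic, neg_zero]
    exact (integrableOn_Ici_iff_integrableOn_Ioi (by simp)).2 h1
  rw [← integrableOn_univ, ← Set.Iic_union_Ioi (a := (0 : ℝ))]
  exact h2.union h1

lemma memLp_extend (hσ : σ ^ 2 = 1) (hf : ContinuousOn f (Set.Ici 0))
    (hi : IntegrableOn (fun x => f x ^ 2) (Set.Ioi 0)) : MemLp (extend σ f) 2 volume := by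
  rw [memLp_two_iff_integrable_sq (measurable_extend hf).aestronglyMeasurable]
  refine (integrable_comp_abs hi).congr (Eventually.of_forall fun x => ?_)
  simp only [extend]
  split_ifs
  · ring
  · rw [mul_pow, hσ, one_mul]

lemma hasDerivAt_extend (hf : ∀ x, 0 ≤ x → HasDerivAt f (f' x) x) {x : ℝ} (hx : x ≠ 0) :
    HasDerivAt (extend σ f) (extend (-σ) f' x) x := by
  rcases lt_or_gt_of_ne hx with h | h
  · rw [extend_of_neg h]
    have h1 := ((hf (-x) (by linarith)).comp x (hasDerivAt_neg x)).const_mul σ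
    refine (h1.congr_of_eventuallyEq ?_).congr_deriv (by ring)
    filter_upwards [Iio_mem_nhds h] with y hy using extend_of_neg hy
  · rw [extend_of_nonneg h.le]
    refine (hf x h.le).congr_of_eventuallyEq ?_
    filter_upwards [Ioi_mem_nhds h] with y hy using extend_of_nonneg (le_of_lt hy)

lemma tendsto_extend_right (hf : ContinuousAt f 0) :
    Tendsto (extend σ f) (𝓝[>] 0) (𝓝 (f 0)) := by
  refine (hf.mono_left nhdsWithin_le_nhds).congr' ?_
  filter_upwards [self_mem_nhdsWithin] with x hx
  exact (extend_of_nonneg (le_of_lt hx)).symm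

lemma tendsto_extend_left (hf : ContinuousAt f 0) :
    Tendsto (extend σ f) (𝓝[<] 0) (𝓝 (σ * f 0)) := by
  have h1 : Tendsto (fun x : ℝ => f (-x)) (𝓝 0) (𝓝 (f 0)) :=
    hf.tendsto.comp (by simpa using (continuous_neg (G := ℝ)).tendsto 0)
  refine ((h1.mono_left nhdsWithin_le_nhds).const_mul σ).congr' ?_
  filter_upwards [self_mem_nhdsWithin] with x hx
  exact (extend_of_neg hx).symm

lemma continuousAt_extend_zero (hf : ContinuousAt f 0) (h0 : f 0 = σ * f 0) :
    ContinuousAt (extend σ f) 0 := by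
  rw [continuousAt_iff_punctured_nhds, ← nhdsLT_sup_nhdsGT, tendsto_sup,
    extend_of_nonneg le_rfl]
  refine ⟨?_, tendsto_extend_right hf⟩
  rw [h0]
  exact tendsto_extend_left hf

/-- The test functions vanish near the origin, so a jump there is not seen. -/
lemma isWeakDerivReal_extend (hf : ∀ x, 0 ≤ x → HasDerivAt f (f' x) x)
    (hi : LocallyIntegrable (extend σ f)) (hi' : LocallyIntegrable (extend (-σ) f')) :
    IsWeakDerivReal {0}ᶜ (extend σ f) (extend (-σ) f') := by
  intro ψ hψ hs hU
  refine integral_deriv_mul_eq (fun x hx => hasDerivAt_extend hf hx) hi hi' hψ hs ?_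
  refine continuous_iff_continuousAt.2 fun x => ?_
  rcases eq_or_ne x 0 with rfl | hx
  · have h0 : (0 : ℝ) ∉ tsupport ψ := fun h => hU h rfl
    have : (fun x => ψ x * extend σ f x) =ᶠ[𝓝 0] fun _ => 0 := by
      filter_upwards [notMem_tsupport_iff_eventuallyEq.1 h0] with y hy
      rw [hy, Pi.zero_apply, zero_mul]
    exact continuousAt_const.congr this.symm
  · exact hψ.continuous.continuousAt.mul (hasDerivAt_extend hf hx).continuousAt

/-- Across the origin continuity is needed: automatic for the even extension, `f 0 = 0` for the odd
one. -/
lemma isWeakDerivReal_extend_univ (hf : ∀ x, 0 ≤ x → HasDerivAt f (f' x) x)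
    (h0 : f 0 = σ * f 0) (hi : LocallyIntegrable (extend σ f))
    (hi' : LocallyIntegrable (extend (-σ) f')) :
    IsWeakDerivReal Set.univ (extend σ f) (extend (-σ) f') := by
  intro ψ hψ hs _
  refine integral_deriv_mul_eq (fun x hx => hasDerivAt_extend hf hx) hi hi' hψ hs ?_
  refine continuous_iff_continuousAt.2 fun x => hψ.continuous.continuousAt.mul ?_
  rcases eq_or_ne x 0 with rfl | hx
  · exact continuousAt_extend_zero (hf 0 le_rfl).continuousAt h0
  · exact (hasDerivAt_extend hf hx).continuousAt

end Extension

/-! ### Parity decomposition of eigenfunctions -/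

section Eigenfunctions

variable {𝕜 : Type*} [RCLike 𝕜]

lemma isWeakDeriv_of_real {U : Set ℝ} {u v : L2 𝕜} {G G' : ℝ → ℝ}
    (hu : u =ᵐ[volume] fun x => (G x : 𝕜)) (hv : v =ᵐ[volume] fun x => (G' x : 𝕜))
    (h : IsWeakDerivReal U G G') : IsWeakDeriv U u v := by
  intro ψ hψ hs hU
  have e {k : ℝ → ℝ} {w : L2 𝕜} {H : ℝ → ℝ} (hw : w =ᵐ[volume] fun x => (H x : 𝕜)) :
      ∫ x, k x • w x = ((∫ x, k x * H x : ℝ) : 𝕜) := by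
    rw [← integral_ofReal]
    refine integral_congr_ae ?_
    filter_upwards [hw] with x hx
    rw [hx, RCLike.real_smul_eq_coe_mul, RCLike.ofReal_mul]
  rw [e hu, e hv, h ψ hψ hs hU, RCLike.ofReal_neg]

lemma IsWeakDeriv.real {U : Set ℝ} {u v : L2 𝕜} (T : 𝕜 →L[ℝ] ℝ) (h : IsWeakDeriv U u v) :
    IsWeakDerivReal U (fun x => T (u x)) (fun x => T (v x)) := by
  intro ψ hψ hs hU
  have e {k : ℝ → ℝ} (hk : Continuous k) (hks : HasCompactSupport k) (w : L2 𝕜) :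
      ∫ x, k x * T (w x) = T (∫ x, k x • w x) := by
    rw [← T.integral_comp_comm (integrable_test hk hks w)]
    simp
  rw [e (hψ.continuous_deriv (by simp)) hs.deriv, e hψ.continuous hs, h ψ hψ hs hU, map_neg]

lemma HasTrace.congr {l : Filter ℝ} {u : L2 𝕜} {G : ℝ → 𝕜} {a : 𝕜} (hu : u =ᵐ[volume] G)
    (h : Tendsto G l (𝓝 a)) : HasTrace l u a := by
  refine (h.mono_left inf_le_left).congr' ?_
  exact (EventuallyEq.symm hu).filter_mono inf_le_right

/-- An interval `(0, ε)` has positive measure, so it meets every set of full measure; this makes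
one-sided traces unique. -/
lemma neBot_nhdsGT_inf_ae : (𝓝[>] (0 : ℝ) ⊓ ae volume).NeBot := by
  rw [inf_neBot_iff]
  intro s hs t ht
  obtain ⟨ε, hε, hεs⟩ := mem_nhdsGT_iff_exists_Ioo_subset.1 hs
  by_contra hne
  rw [Set.not_nonempty_iff_eq_empty] at hne
  have hsub : Set.Ioo 0 ε ⊆ tᶜ := fun x hx hxt =>
    (hne ▸ (⟨hεs hx, hxt⟩ : x ∈ s ∩ t) : x ∈ (∅ : Set ℝ))
  have h0 := measure_mono_null hsub (mem_ae_iff.1 ht)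
  rw [Real.volume_Ioo, ENNReal.ofReal_eq_zero] at h0
  have : 0 < ε := hε
  linarith

lemma trace_eq {k : ℝ → ℝ} {f : ℝ → ℝ} {a : ℝ} (h : Tendsto k (𝓝[>] 0 ⊓ ae volume) (𝓝 a))
    (hk : ∀ᵐ x, 0 < x → k x = f x) (hf : ContinuousAt f 0) : a = f 0 := by
  have := neBot_nhdsGT_inf_ae
  have h1 : Tendsto f (𝓝[>] 0 ⊓ ae volume) (𝓝 (f 0)) :=
    hf.tendsto.mono_left (inf_le_left.trans nhdsWithin_le_nhds)
  refine tendsto_nhds_unique h (h1.congr' ?_)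
  have hpos : ∀ᶠ x : ℝ in 𝓝[>] 0 ⊓ ae volume, 0 < x :=
    (eventually_mem_nhdsWithin (a := (0 : ℝ)) (s := Set.Ioi 0)).filter_mono inf_le_left
  filter_upwards [hpos, hk.filter_mono inf_le_right] with x hx hkx
  exact (hkx hx).symm

lemma tendsto_neg_inf_ae : Tendsto (fun x : ℝ => -x) (𝓝[>] 0 ⊓ ae volume)
    (𝓝[<] 0 ⊓ ae volume) := by
  refine tendsto_inf.2 ⟨?_, ?_⟩
  · have : Tendsto (fun x : ℝ => -x) (𝓝[>] 0) (𝓝[<] (-0)) := tendsto_neg_nhdsGT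
    rw [neg_zero] at this
    exact this.mono_left inf_le_left
  · exact (Measure.measurePreserving_neg
      (volume : Measure ℝ)).quasiMeasurePreserving.tendsto_ae.mono_left inf_le_right

lemma ae_comp_neg {p : ℝ → Prop} (h : ∀ᵐ x, p x) : ∀ᵐ x : ℝ, p (-x) :=
  (Measure.measurePreserving_neg
    (volume : Measure ℝ)).quasiMeasurePreserving.tendsto_ae.eventually h

/-- Any real-linear functional of a weak eigenfunction is a combination of the extensions of the
two fundamental solutions of the half-line problem. -/
lemma eq_combination_of_functional {q : ℝ → ℝ} {B : ℝ} (hB : ∀ x, |q x| ≤ B) (hq : Continuous q)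
    {μ Z Y κ : ℝ} (hY : 0 ≤ Y) (hκ : 0 ≤ κ) (hqY : ∀ y, Y ≤ y → κ ≤ q y - μ)
    {E E' O O' : ℝ → ℝ} (hE : IsSol q μ E E') (hO : IsSol q μ O O') (hE0 : E 0 = 1)
    (hE0' : E' 0 = -(Z / 2)) (hO0 : O 0 = 0) (hO0' : O' 0 = 1) {u v w : L2 𝕜}
    (huv : IsH2Off u v w) {a b c : 𝕜} (ha : HasTrace (𝓝[>] 0) v a) (hb : HasTrace (𝓝[<] 0) v b)
    (hc : HasTrace (𝓝 0) u c) (hj : a - b = -(Z : 𝕜) * c)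
    (he : ∀ᵐ x, w x = ((q |x| - μ : ℝ) : 𝕜) * u x) (T : 𝕜 →L[ℝ] ℝ) :
    (∀ᵐ x, T (u x) = T c * extend 1 E x + T (a + (Z / 2 : ℝ) • c) * extend (-1) O x) ∧
      (T c ≠ 0 → Decaying Y E E') ∧ (T (a + (Z / 2 : ℝ) • c) ≠ 0 → Decaying Y O O') := by
  have hmem (z : L2 𝕜) : MemLp (fun x => T (z x)) 2 volume :=
    T.comp_memLp' (Lp.memLp z)
  have hloc (z : L2 𝕜) : LocallyIntegrable (fun x => T (z x)) :=
    (hmem z).locallyIntegrable (by norm_num)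
  have hneg {k : ℝ → ℝ} (hk : MemLp k 2 volume) : MemLp (fun x => k (-x)) 2 volume :=
    hk.comp_measurePreserving (Measure.measurePreserving_neg volume)
  have hlocn (z : L2 𝕜) : LocallyIntegrable (fun x => T (z (-x))) :=
    (hneg (hmem z)).locallyIntegrable (by norm_num)
  have heT : ∀ᵐ x, T (w x) = (q |x| - μ) * T (u x) := by
    filter_upwards [he] with x hx
    rw [hx, ← RCLike.real_smul_eq_coe_mul, map_smul, smul_eq_mul]
  obtain ⟨f, f', hf, hfu, hfv⟩ := exists_isSol_of_weak hq (μ := μ) (hloc u) (hloc v) (hloc w)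
    ((huv.1.real T).mono (by simp)) ((huv.2.real T).mono (by simp)) (by
      filter_upwards [heT] with x hx hpos
      rw [hx, abs_of_pos hpos])
  have hsub : Set.Ioi (0 : ℝ) ⊆ -{0}ᶜ := fun x hx => by
    simpa using (ne_of_gt hx : x ≠ 0)
  have hw2 : IsWeakDerivReal (Set.Ioi 0) (fun x => -T (v (-x))) (fun x => T (w (-x))) := by
    intro ψ hψ hs hU
    have := ((huv.2.real T).comp_neg.mono hsub) ψ hψ hs hU
    simp only [mul_neg, integral_neg, neg_neg] at this ⊢
    rw [this]
  -- The left half, reflected, solves the same half-line equation because the potential is even.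
  obtain ⟨g, g', hg, hgu, hgv⟩ := exists_isSol_of_weak hq (μ := μ) (hlocn u) (hlocn v).neg
    (hlocn w) ((huv.1.real T).comp_neg.mono hsub) hw2 (by
      filter_upwards [ae_comp_neg heT] with x hx hpos
      rw [hx, abs_neg, abs_of_pos hpos])
  have hTt {l : Filter ℝ} {z : L2 𝕜} {d : 𝕜} (h : HasTrace l z d) :
      Tendsto (fun x => T (z x)) (l ⊓ ae volume) (𝓝 (T d)) := (T.continuous.tendsto d).comp h
  have hle : 𝓝[>] (0 : ℝ) ⊓ ae volume ≤ 𝓝 0 ⊓ ae volume :=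
    inf_le_inf_right _ nhdsWithin_le_nhds
  have hle' : 𝓝[<] (0 : ℝ) ⊓ ae volume ≤ 𝓝 0 ⊓ ae volume :=
    inf_le_inf_right _ nhdsWithin_le_nhds
  have hf0 : T c = f 0 :=
    trace_eq ((hTt hc).mono_left hle) hfu (hf.deriv 0 le_rfl).continuousAt
  have hf0' : T a = f' 0 := trace_eq (hTt ha) hfv (hf.deriv' 0 le_rfl).continuousAt
  have hg0 : T c = g 0 :=
    trace_eq (((hTt hc).mono_left hle').comp tendsto_neg_inf_ae) hgu
      (hg.deriv 0 le_rfl).continuousAt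
  have hg0' : -T b = g' 0 :=
    trace_eq ((hTt hb).comp tendsto_neg_inf_ae).neg hgv (hg.deriv' 0 le_rfl).continuousAt
  have hjT : T a - T b = -Z * T c := by
    rw [← map_sub, hj, ← RCLike.ofReal_neg, ← RCLike.real_smul_eq_coe_mul, map_smul, smul_eq_mul]
  -- The coefficient of the odd part. The jump condition makes the slopes `T a` of `f` and `-T b` of
  -- `g` equal to `-(Z/2) T c ± D`, whence `f = T c E + D O` and `g = T c E - D O`.
  set D := T (a + (Z / 2 : ℝ) • c) with hD
  have hD' : D = T a + Z / 2 * T c := by rw [hD, map_add, map_smul, smul_eq_mul]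
  have hcomb (s : ℝ) : IsSol q μ (fun x => T c * E x + s * O x)
      (fun x => T c * E' x + s * O' x) :=
    ⟨fun x hx => ((hE.deriv x hx).const_mul _).add ((hO.deriv x hx).const_mul _), fun x hx =>
      (((hE.deriv' x hx).const_mul _).add ((hO.deriv' x hx).const_mul _)).congr_deriv (by ring)⟩
  have hfeq (x : ℝ) (hx : 0 ≤ x) : f x = T c * E x + D * O x :=
    (hf.unique hB (hcomb D) le_rfl (by rw [← hf0, hE0, hO0]; ring)
      (by rw [← hf0', hE0', hO0', hD']; ring) hx).1
  have hgeq (x : ℝ) (hx : 0 ≤ x) : g x = T c * E x + -D * O x :=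
    (hg.unique hB (hcomb (-D)) le_rfl (by rw [← hg0, hE0, hO0]; ring)
      (by rw [← hg0', hE0', hO0', hD']; linear_combination hjT) hx).1
  have hfi : MemLp f 2 (volume.restrict (Set.Ioi 0)) :=
    (memLp_congr_ae ((ae_restrict_iff' measurableSet_Ioi).2 hfu)).1 ((hmem u).restrict _)
  have hgi : MemLp g 2 (volume.restrict (Set.Ioi 0)) :=
    (memLp_congr_ae ((ae_restrict_iff' measurableSet_Ioi).2 hgu)).1
      ((hneg (hmem u)).restrict _)
  refine ⟨?_, fun hne => ?_, fun hne => ?_⟩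
  · have hn0 : ∀ᵐ x : ℝ, x ≠ 0 := by simp [ae_iff]
    filter_upwards [hfu, ae_comp_neg hgu, hn0] with x h1 h2 hx
    rcases lt_or_gt_of_ne hx with h | h
    · rw [extend_of_neg h, extend_of_neg h]
      rw [neg_neg] at h2
      rw [h2 (by linarith), hgeq _ (by linarith)]
      ring
    · rw [extend_of_nonneg h.le, extend_of_nonneg h.le, h1 h, hfeq _ h.le]
  -- `f + g = 2 (T c) E` is square integrable; likewise `f - g = 2 D O` below.
  · refine hE.decaying_of_integrableOn hY hκ hqY ?_
    refine (((hfi.add hgi).integrable_sq).const_mul ((2 * T c) ^ 2)⁻¹).congr ?_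
    filter_upwards [ae_restrict_mem measurableSet_Ioi] with x hx
    rw [Pi.add_apply, hfeq x (le_of_lt hx), hgeq x (le_of_lt hx)]
    field_simp
    ring
  · refine hO.decaying_of_integrableOn hY hκ hqY ?_
    refine (((hfi.sub hgi).integrable_sq).const_mul ((2 * D) ^ 2)⁻¹).congr ?_
    filter_upwards [ae_restrict_mem measurableSet_Ioi] with x hx
    rw [Pi.sub_apply, hfeq x (le_of_lt hx), hgeq x (le_of_lt hx)]
    field_simp
    ring

end Eigenfunctions

/-! ### Eigenspaces below zero -/

section Eigenspaces

variable {𝕜 : Type*} [RCLike 𝕜] {lam₁ lam₂ ω Z : ℝ}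

/-- Eigenfunctions of the linearized operator in terms of weak derivatives. -/
lemma mem_eigenspace_iff (h : Admissible lam₁ lam₂ ω Z) {μ : ℝ} {u : L2 𝕜} :
    u ∈ eigenspace (L1 𝕜 lam₁ lam₂ ω Z) (μ : 𝕜) ↔ MemH1 u ∧ ∃ v w, IsH2Off u v w ∧
      JumpCond Z u v ∧ ∀ᵐ x, w x = ((potential lam₁ lam₂ ω Z x - μ : ℝ) : 𝕜) * u x := by
  have key {v w : L2 𝕜} (hv : IsH2Off u v w) (hu : u ∈ (L1 𝕜 lam₁ lam₂ ω Z).domain) :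
      L1 𝕜 lam₁ lam₂ ω Z ⟨u, hu⟩ = (μ : 𝕜) • u ↔
        ∀ᵐ x, w x = ((potential lam₁ lam₂ ω Z x - μ : ℝ) : 𝕜) * u x := by
    have hm : MemLp (fun x => (potential lam₁ lam₂ ω Z x : 𝕜) * u x) 2 volume := hu.2
    have e : L1 𝕜 lam₁ lam₂ ω Z ⟨u, hu⟩ = -w + hm.toLp := by
      change -secondDeriv (⟨u, hu.1⟩ : deltaDomain 𝕜 Z) + hm.toLp = _
      rw [secondDeriv_eq (u := ⟨u, hu.1⟩) hv]
    rw [e, Lp.ext_iff]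
    constructor
    · intro hae
      filter_upwards [hae, Lp.coeFn_add (-w) hm.toLp, Lp.coeFn_neg w, hm.coeFn_toLp,
        Lp.coeFn_smul (μ : 𝕜) u] with x h1 h2 h3 h4 h5
      rw [h2, Pi.add_apply, h3, Pi.neg_apply, h4, h5, Pi.smul_apply, smul_eq_mul] at h1
      rw [RCLike.ofReal_sub]
      linear_combination -h1
    · intro hae
      filter_upwards [hae, Lp.coeFn_add (-w) hm.toLp, Lp.coeFn_neg w, hm.coeFn_toLp,
        Lp.coeFn_smul (μ : 𝕜) u] with x h1 h2 h3 h4 h5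
      rw [h2, Pi.add_apply, h3, Pi.neg_apply, h4, h5, Pi.smul_apply, smul_eq_mul, h1,
        RCLike.ofReal_sub]
      ring
  constructor
  · rintro ⟨hu, heq⟩
    obtain ⟨h1, v, w, hv, hj⟩ := hu.1
    exact ⟨h1, v, w, hv, hj, (key hv hu).1 heq⟩
  · rintro ⟨h1, v, w, hv, hj, hae⟩
    have hu : u ∈ (L1 𝕜 lam₁ lam₂ ω Z).domain := by
      rw [L1_domain 𝕜 h]
      exact ⟨h1, v, w, hv, hj⟩
    exact ⟨hu, (key hv hu).2 hae⟩

/-- The converse direction of the half-line reduction. The one-sided slopes of the extension are `f'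
0` and `-σ f' 0`, so `hj` is the jump condition: `2 f' 0 = -Z f 0` for `σ = 1`, and `f 0 = 0`
suffices for `Z`-independence when `σ = -1`. -/
lemma exists_eigenfunction (h : Admissible lam₁ lam₂ ω Z) {q : ℝ → ℝ} {B Y c : ℝ} {ψ ψ' : ℝ → ℝ}
    (hq : HalfLineData q B Y c Z ψ ψ') (hpot : ∀ x, potential lam₁ lam₂ ω Z x = q |x|) {μ : ℝ}
    (hμ : μ < 0) {f f' : ℝ → ℝ} (hf : IsSol q μ f f') (hd : Decaying Y f f') {σ : ℝ}
    (hσ : σ ^ 2 = 1) (h0 : f 0 = σ * f 0) (hj : f' 0 + σ * f' 0 = -Z * f 0) :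
    ∃ u : L2 𝕜, u =ᵐ[volume] (fun x => (extend σ f x : 𝕜)) ∧
      u ∈ eigenspace (L1 𝕜 lam₁ lam₂ ω Z) (μ : 𝕜) := by
  obtain ⟨i1, i2⟩ := hd.integrableOn hq.Y_nonneg hq.c_pos
    (fun y hy => by linarith [hq.le y hy]) hf
  have m1 : MemLp (extend σ f) 2 volume := memLp_extend hσ hf.continuousOn i1
  have m2 : MemLp (extend (-σ) f') 2 volume := memLp_extend (by rw [neg_sq, hσ]) hf.continuousOn' i2
  have e3 : extend σ (fun x => (q x - μ) * f x) = fun x => (q |x| - μ) * extend σ f x := by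
    ext x
    simp only [extend]
    ring
  have hqc := hq.continuous
  have m3 : MemLp (extend σ fun x => (q x - μ) * f x) 2 volume := by
    refine m1.of_le_mul (c := B + |μ|) (measurable_extend
      ((hqc.sub continuous_const).continuousOn.mul hf.continuousOn)).aestronglyMeasurable
      (Eventually.of_forall fun x => ?_)
    rw [e3, norm_mul]
    gcongr
    exact (abs_sub _ _).trans (by gcongr; exact hq.bound _)
  have hl {k : ℝ → ℝ} (hk : MemLp k 2 volume) : LocallyIntegrable k :=
    hk.locallyIntegrable (by norm_num)
  have hco {k : ℝ → ℝ} (hk : MemLp k 2 volume) : (hk.ofReal (K := 𝕜)).toLp =ᵐ[volume]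
      fun x => (k x : 𝕜) := hk.ofReal.coeFn_toLp
  have hcont := (hf.deriv 0 le_rfl).continuousAt
  have hcont' := (hf.deriv' 0 le_rfl).continuousAt
  have hofReal (x : ℝ) := (RCLike.continuous_ofReal (K := 𝕜)).tendsto x
  refine ⟨(m1.ofReal (K := 𝕜)).toLp, hco m1, (mem_eigenspace_iff h).2
    ⟨⟨(m2.ofReal (K := 𝕜)).toLp, isWeakDeriv_of_real (hco m1) (hco m2)
      (isWeakDerivReal_extend_univ hf.deriv h0 (hl m1) (hl m2))⟩,
    (m2.ofReal (K := 𝕜)).toLp, (m3.ofReal (K := 𝕜)).toLp,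
    ⟨isWeakDeriv_of_real (hco m1) (hco m2) (isWeakDerivReal_extend hf.deriv (hl m1) (hl m2)),
      isWeakDeriv_of_real (hco m2) (hco m3) ?_⟩,
    ⟨((f' 0 : ℝ) : 𝕜), ((-σ * f' 0 : ℝ) : 𝕜), ((f 0 : ℝ) : 𝕜),
      .congr (hco m2) ((hofReal _).comp (tendsto_extend_right hcont')),
      .congr (hco m2) ((hofReal _).comp (tendsto_extend_left hcont')),
      .congr (hco m1) ((hofReal _).comp ?_), ?_⟩, ?_⟩⟩
  · have := isWeakDerivReal_extend (σ := -σ) hf.deriv' (hl m2) (by rw [neg_neg]; exact hl m3)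
    rwa [neg_neg] at this
  · have := (continuousAt_extend_zero (σ := σ) hcont h0).tendsto
    rwa [extend_of_nonneg le_rfl] at this
  · rw [← RCLike.ofReal_sub, ← RCLike.ofReal_neg, ← RCLike.ofReal_mul, ← hj]
    congr 1
    ring
  · filter_upwards [hco m1, hco m3] with x hx1 hx3
    rw [hx1, hx3, e3, hpot, RCLike.ofReal_mul]

lemma extend_not_ae_zero {q : ℝ → ℝ} {B μ : ℝ} (hB : ∀ x, |q x| ≤ B) {f f' : ℝ → ℝ}
    (hf : IsSol q μ f f') (hne : f 0 ≠ 0 ∨ f' 0 ≠ 0) {σ : ℝ} :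
    ¬ extend σ f =ᵐ[volume] fun _ => 0 := by
  intro hae
  have hk : ∀ᵐ x : ℝ, 0 < x → (0 : ℝ) = f x := by
    filter_upwards [hae] with x hx hpos
    rw [← hx, extend_of_nonneg hpos.le]
  have hz : ∀ x : ℝ, 0 < x → f x = 0 := by
    have : ∀ᵐ x ∂(volume.restrict (Set.Ioi (0 : ℝ))), f x = (fun _ => (0 : ℝ)) x := by
      rw [ae_restrict_iff' measurableSet_Ioi]
      filter_upwards [hk] with x hx hpos using (hx hpos).symm
    exact fun x hx => Measure.eqOn_open_of_ae_eq this isOpen_Ioi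
      (hf.continuousOn.mono Set.Ioi_subset_Ici_self) continuousOn_const hx
  have hz' : f' 1 = 0 := by
    refine (hf.deriv 1 zero_le_one).unique
      ((hasDerivAt_const (1 : ℝ) (0 : ℝ)).congr_of_eventuallyEq ?_)
    filter_upwards [Ioi_mem_nhds one_pos] with y hy using hz y hy
  rcases hf.ne_zero hB hne zero_le_one with h | h
  · exact h (hz 1 one_pos)
  · exact h hz'

/-- The eigenspace below zero: one-dimensional if one of the two fundamental solutions decays,
trivial otherwise. -/
lemma rank_eigenspace (h : Admissible lam₁ lam₂ ω Z) {q : ℝ → ℝ} {B Y c : ℝ} {ψ ψ' : ℝ → ℝ}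
    (hq : HalfLineData q B Y c Z ψ ψ') (hpot : ∀ x, potential lam₁ lam₂ ω Z x = q |x|) {μ : ℝ}
    (hμ : μ < 0) {E E' O O' : ℝ → ℝ} (hE : IsSol q μ E E') (hO : IsSol q μ O O') (hE0 : E 0 = 1)
    (hE0' : E' 0 = -(Z / 2)) (hO0 : O 0 = 0) (hO0' : O' 0 = 1) :
    ((Decaying Y E E' ∨ Decaying Y O O') →
      Module.rank 𝕜 (eigenspace (L1 𝕜 lam₁ lam₂ ω Z) (μ : 𝕜)) = 1) ∧
    (¬ (Decaying Y E E' ∨ Decaying Y O O') →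
      eigenspace (L1 𝕜 lam₁ lam₂ ω Z) (μ : 𝕜) = ⊥) := by
  have hqμ (y : ℝ) (hy : Y ≤ y) : c ≤ q y - μ := by linarith [hq.le y hy]
  have hdecomp {u : L2 𝕜} (hu : u ∈ eigenspace (L1 𝕜 lam₁ lam₂ ω Z) (μ : 𝕜)) :
      ∃ s t : 𝕜, (∀ᵐ x, u x = s * (extend 1 E x : 𝕜) + t * (extend (-1) O x : 𝕜)) ∧
        (s ≠ 0 → Decaying Y E E') ∧ (t ≠ 0 → Decaying Y O O') := by
    obtain ⟨-, v, w, hv, ⟨a, b, d, ha, hb, hd, hj⟩, he⟩ := (mem_eigenspace_iff h).1 hu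
    simp only [hpot] at he
    -- Real and imaginary parts are treated separately and reassembled; this covers both scalar
    -- fields at once.
    have hT := eq_combination_of_functional hq.bound hq.continuous hq.Y_nonneg hq.c_pos.le hqμ
      hE hO hE0 hE0' hO0 hO0' hv ha hb hd hj he
    have hre := hT RCLike.reCLM
    have him := hT RCLike.imCLM
    simp only [RCLike.reCLM_apply, RCLike.imCLM_apply] at hre him
    refine ⟨d, a + (Z / 2 : ℝ) • d, ?_, fun hs => ?_, fun ht => ?_⟩
    · filter_upwards [hre.1, him.1] with x h1 h2
      generalize a + (Z / 2 : ℝ) • d = t at h1 h2 ⊢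
      apply RCLike.ext
      · rw [h1, map_add, RCLike.re_mul_ofReal, RCLike.re_mul_ofReal]
      · rw [h2, map_add, RCLike.im_mul_ofReal, RCLike.im_mul_ofReal]
    · by_contra hnd
      refine hs (RCLike.ext ?_ ?_)
      · rw [map_zero]; by_contra hne; exact hnd (hre.2.1 hne)
      · rw [map_zero]; by_contra hne; exact hnd (him.2.1 hne)
    · by_contra hnd
      refine ht (RCLike.ext ?_ ?_)
      · rw [map_zero]; by_contra hne; exact hnd (hre.2.2 hne)
      · rw [map_zero]; by_contra hne; exact hnd (him.2.2 hne)
  have hspan {f f' : ℝ → ℝ} {σ : ℝ} (hf : IsSol q μ f f') (hne : f 0 ≠ 0 ∨ f' 0 ≠ 0)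
      {u₀ : L2 𝕜} (hu₀ : u₀ =ᵐ[volume] fun x => (extend σ f x : 𝕜))
      (hmem : u₀ ∈ eigenspace (L1 𝕜 lam₁ lam₂ ω Z) (μ : 𝕜))
      (hall : ∀ u ∈ eigenspace (L1 𝕜 lam₁ lam₂ ω Z) (μ : 𝕜), ∃ s : 𝕜,
        ∀ᵐ x, u x = s * (extend σ f x : 𝕜)) :
      Module.rank 𝕜 (eigenspace (L1 𝕜 lam₁ lam₂ ω Z) (μ : 𝕜)) = 1 := by
    refine (rank_submodule_eq_one_iff _).2 ⟨u₀, hmem, ?_, fun u hu => ?_⟩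
    · rintro rfl
      refine extend_not_ae_zero hq.bound hf hne (σ := σ) ?_
      filter_upwards [hu₀, Lp.coeFn_zero 𝕜 2 (volume : Measure ℝ)] with x h1 h2
      rw [h1, Pi.zero_apply] at h2
      exact_mod_cast h2
    · obtain ⟨s, hs⟩ := hall u hu
      refine Submodule.mem_span_singleton.2 ⟨s, Lp.ext ?_⟩
      filter_upwards [hs, hu₀, Lp.coeFn_smul s u₀] with x h1 h2 h3
      rw [h3, Pi.smul_apply, smul_eq_mul, h1, h2]
  have hexcl : Decaying Y E E' → ¬ Decaying Y O O' :=
    not_both_decaying hq.bound hq.continuous hq.Y_nonneg hq.c_pos hqμ hE hO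
      (by rw [hE0, hE0', hO0, hO0']; norm_num)
  constructor
  · rintro (hd | hd)
    · obtain ⟨u₀, hu₀, hmem⟩ := exists_eigenfunction (𝕜 := 𝕜) h hq hpot hμ hE hd (σ := 1)
        (by norm_num) (by ring) (by rw [hE0, hE0']; ring)
      refine hspan hE (.inl (by simp [hE0])) hu₀ hmem fun u hu => ?_
      obtain ⟨s, t, h1, -, h3⟩ := hdecomp hu
      have ht : t = 0 := by
        by_contra hne
        exact hexcl hd (h3 hne)
      exact ⟨s, by simpa [ht] using h1⟩
    · obtain ⟨u₀, hu₀, hmem⟩ := exists_eigenfunction (𝕜 := 𝕜) h hq hpot hμ hO hd (σ := -1)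
        (by norm_num) (by rw [hO0]; ring) (by rw [hO0, hO0']; ring)
      refine hspan hO (.inr (by simp [hO0'])) hu₀ hmem fun u hu => ?_
      obtain ⟨s, t, h1, h2, -⟩ := hdecomp hu
      have hs : s = 0 := by
        by_contra hne
        exact hexcl (h2 hne) hd
      exact ⟨t, by simpa [hs] using h1⟩
  · intro hnd
    rw [not_or] at hnd
    refine (Submodule.eq_bot_iff _).2 fun u hu => ?_
    obtain ⟨s, t, h1, h2, h3⟩ := hdecomp hu
    have hs : s = 0 := by
      by_contra hne
      exact hnd.1 (h2 hne)
    have ht : t = 0 := by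
      by_contra hne
      exact hnd.2 (h3 hne)
    refine Lp.ext ?_
    filter_upwards [h1, Lp.coeFn_zero 𝕜 2 (volume : Measure ℝ)] with x hx hx0
    rw [hx, hx0, hs, ht]
    simp

end Eigenspaces

/-! ### Counting with and without multiplicity -/

section Counting

/-- If the eigenspaces below zero are lines for spectral parameters in `S` and trivial otherwise,
both counts of negative eigenvalues equal the cardinality of `S`. -/
lemma count_eq {𝕜 H : Type*} [RCLike 𝕜] [AddCommGroup H] [Module 𝕜 H] (A : H →ₗ.[𝕜] H)
    (S : Finset ℝ) (hS : ∀ μ ∈ S, μ < 0)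
    (h1 : ∀ μ ∈ S, Module.rank 𝕜 (eigenspace A (μ : 𝕜)) = 1)
    (h0 : ∀ μ < 0, μ ∉ S → eigenspace A (μ : 𝕜) = ⊥) :
    numNegEigenvalues A = S.card ∧ (negEigenvalues A).encard = S.card := by
  constructor
  · have hinj : Set.InjOn (fun μ : Set.Iio (0 : ℝ) => (μ : ℝ))
        ((fun μ : Set.Iio (0 : ℝ) => (μ : ℝ)) ⁻¹' (S : Set ℝ)) := Subtype.coe_injective.injOn
    unfold numNegEigenvalues
    rw [tsum_eq_sum (s := S.preimage _ hinj)]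
    · rw [Finset.sum_congr rfl (g := fun _ => (1 : ℕ∞))]
      · rw [Finset.sum_const, nsmul_eq_mul, mul_one, Nat.cast_inj,
          ← Finset.card_image_of_injective _ Subtype.coe_injective]
        congr 1
        ext μ
        simp only [Finset.mem_image, Finset.mem_preimage, Subtype.exists, Set.mem_Iio,
          exists_and_left, exists_prop, exists_eq_right_right]
        exact ⟨fun h => h.1, fun h => ⟨h, hS μ h⟩⟩
      · intro μ hμ
        rw [h1 μ (Finset.mem_preimage.1 hμ), map_one]
    · intro μ hμ
      rw [h0 μ μ.2 (fun h => hμ (Finset.mem_preimage.2 h)), rank_bot, map_zero]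
  · have : negEigenvalues A = S := by
      ext μ
      constructor
      · rintro ⟨hμ, u, hu, hmem⟩
        by_contra hn
        rw [h0 μ hμ hn] at hmem
        exact hu ((Submodule.mem_bot 𝕜).1 hmem)
      · intro hμ
        refine ⟨hS μ hμ, ?_⟩
        obtain ⟨u, hu, hu0, -⟩ := (rank_submodule_eq_one_iff _).1 (h1 μ hμ)
        exact ⟨u, hu0, hu⟩
    rw [this, Set.encard_coe_eq_coe_finsetCard]

end Counting

end DeltaNLS

theorem theorem4p5 {𝕜 : Type*} [RCLike 𝕜] (lam₁ lam₂ ω Z : ℝ)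
    (h : DeltaNLS.Admissible lam₁ lam₂ ω Z) :
    (Z < 0 →
      DeltaNLS.numNegEigenvalues (DeltaNLS.L1 𝕜 lam₁ lam₂ ω Z) = 2 ∧
      (DeltaNLS.negEigenvalues (DeltaNLS.L1 𝕜 lam₁ lam₂ ω Z)).encard = 2) ∧
    (0 < Z →
      DeltaNLS.numNegEigenvalues (DeltaNLS.L1 𝕜 lam₁ lam₂ ω Z) = 1 ∧
      (DeltaNLS.negEigenvalues (DeltaNLS.L1 𝕜 lam₁ lam₂ ω Z)).encard = 1) := by
  obtain ⟨q, B, Y, c, ψ, ψ', hq, hpot⟩ := h.exists_halfLineData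
  choose E E' hE hE0 hE0' using fun μ =>
    DeltaNLS.exists_isSol hq.continuous hq.bound μ 1 (-(Z / 2))
  choose O O' hO hO0 hO0' using fun μ => DeltaNLS.exists_isSol hq.continuous hq.bound μ 0 1
  have hrank {μ : ℝ} (hμ : μ < 0) := DeltaNLS.rank_eigenspace (𝕜 := 𝕜) h hq hpot hμ (hE μ) (hO μ)
    (hE0 μ) (hE0' μ) (hO0 μ) (hO0' μ)
  have hlog := hq.logConcave
  -- The even eigenvalue exists for either sign of `Z`; its Wronskian condition is log-concavity.
  obtain ⟨μ₁, hμ₁, hd₁⟩ := DeltaNLS.exists_decaying hq.bound hq.continuous hq.Y_nonneg hq.c_pos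
    hq.le hq.sol hq.neg hq.tendsto hq.tendsto' (a := 1) (b := -(Z / 2)) (M := |Z| + 1)
    zero_le_one (by have := le_abs_self Z; have := abs_nonneg Z; linarith) (by linarith)
    hE hE0 hE0'
  constructor
  · intro hZ
    obtain ⟨hψ0, x₀, hx₀, hψx⟩ := hq.of_neg hZ
    -- For the data `(0, 1)` the Wronskian condition is `ψ(0) > 0`, which holds because `Z < 0`.
    obtain ⟨μ₂, hμ₂, hd₂⟩ := DeltaNLS.exists_decaying hq.bound hq.continuous hq.Y_nonneg hq.c_pos
      hq.le hq.sol hq.neg hq.tendsto hq.tendsto' (a := 0) (b := 1) (M := 0)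
      le_rfl (by norm_num) (by linarith) hO hO0 hO0'
    have hne : μ₁ ≠ μ₂ := by
      rintro rfl
      exact DeltaNLS.not_both_decaying hq.bound hq.continuous hq.Y_nonneg hq.c_pos
        (fun y hy => by linarith [hq.le y hy]) (hE μ₁) (hO μ₁)
        (by rw [hE0, hE0', hO0, hO0']; norm_num) hd₁ hd₂
    -- The boundary inequality is `ψ'(0)/ψ(0) ≤ -Z/2`, log-concavity again; for `O` it reads `0 ≤
    -- 0`.
    have huE {μ : ℝ} (hμ : μ < 0) (hd : DeltaNLS.Decaying Y (E μ) (E' μ)) : μ = μ₁ :=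
      DeltaNLS.decaying_unique hq.bound hq.continuous hq.Y_nonneg hq.c_pos hq.le hq.sol hq.tendsto
        hq.tendsto' hψ0.ne' hx₀ hψx hμ hμ₁ (hE μ) (hE μ₁) hd hd₁ (.inl one_ne_zero) (hE0 μ)
        (hE0' μ) (hE0 μ₁) (hE0' μ₁) (.inr (by
          rw [one_pow, mul_one, one_mul, div_le_iff₀ hψ0]
          linarith))
    have huO {μ : ℝ} (hμ : μ < 0) (hd : DeltaNLS.Decaying Y (O μ) (O' μ)) : μ = μ₂ :=
      DeltaNLS.decaying_unique hq.bound hq.continuous hq.Y_nonneg hq.c_pos hq.le hq.sol hq.tendsto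
        hq.tendsto' hψ0.ne' hx₀ hψx hμ hμ₂ (hO μ) (hO μ₂) hd hd₂ (.inr one_ne_zero) (hO0 μ)
        (hO0' μ) (hO0 μ₂) (hO0' μ₂) (.inr (by simp))
    have := DeltaNLS.count_eq (DeltaNLS.L1 𝕜 lam₁ lam₂ ω Z) {μ₁, μ₂}
      (by simp [hμ₁, hμ₂])
      (by
        intro μ hμ
        rw [Finset.mem_insert, Finset.mem_singleton] at hμ
        rcases hμ with rfl | rfl
        · exact (hrank hμ₁).1 (.inl hd₁)
        · exact (hrank hμ₂).1 (.inr hd₂))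
      (by
        intro μ hμ hμS
        rw [Finset.mem_insert, Finset.mem_singleton] at hμS
        exact (hrank hμ).2 fun hd => hμS (hd.imp (huE hμ) (huO hμ)))
    rw [Finset.card_pair hne] at this
    exact_mod_cast this
  · intro hZ
    have hψx := hq.of_pos hZ
    -- Now `ψ` has no zero, so `x₀ = 0` is allowed and no boundary inequality is needed.
    have huE {μ : ℝ} (hμ : μ < 0) (hd : DeltaNLS.Decaying Y (E μ) (E' μ)) : μ = μ₁ :=
      DeltaNLS.decaying_unique hq.bound hq.continuous hq.Y_nonneg hq.c_pos hq.le hq.sol hq.tendsto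
        hq.tendsto' (hψx 0 le_rfl) le_rfl (fun x hx _ => hψx x hx) hμ hμ₁ (hE μ) (hE μ₁) hd hd₁
        (.inl one_ne_zero) (hE0 μ) (hE0' μ) (hE0 μ₁) (hE0' μ₁) (.inl rfl)
    have hnO {μ : ℝ} (hμ : μ < 0) : ¬ DeltaNLS.Decaying Y (O μ) (O' μ) :=
      DeltaNLS.not_decaying_of_eq_zero hq.bound hq.continuous hq.Y_nonneg hq.c_pos hq.le hq.sol
        hq.tendsto hq.tendsto' hψx hμ (hO μ) (hO0 μ) (by rw [hO0']; exact one_ne_zero)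
    have := DeltaNLS.count_eq (DeltaNLS.L1 𝕜 lam₁ lam₂ ω Z) {μ₁} (by simp [hμ₁])
      (by
        intro μ hμ
        rw [Finset.mem_singleton] at hμ
        rw [hμ]
        exact (hrank hμ₁).1 (.inl hd₁))
      (by
        intro μ hμ hμS
        rw [Finset.mem_singleton] at hμS
        exact (hrank hμ).2 fun hd => hd.elim (fun hd => hμS (huE hμ hd)) (hnO hμ))
    rw [Finset.card_singleton] at this
    exact_mod_cast this
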